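/- A triangulated closed surface is a finite (abstract) simplicial complex whose geometric realization is a 2-dimensional topological manifold without boundary; it is connected if its realization is connected (and nonempty). For integers $f, w \ge 0$, let $T(f,w)$ be the set of connected triangulated closed surfaces with exactly $f$ two-dimensional faces and exactly $w$ vertices, up to simplicial isomorphism (a bijection between the vertex sets under which faces correspond to faces). For every $\delta > 0$ there is a constant $C_\delta > 0$ such that for all integers $f, w \ge 0$ $$|T(f,w)| \le C_\delta^{\,f}\, f^{f/2}\, w^{-(1-\delta)w},$$ with the convention $0^0 = 1$. -/

import Mathlib

namespace TriangulatedSurface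

/-- The geometric realization of a simplicial complex `K` on a finite vertex set `V`, in barycentric
coordinates: the points of the standard simplex whose support lies in some face of `K`. As a type it
carries the subspace topology from `V → ℝ`. -/
def realization {V : Type*} [Fintype V] (K : AbstractSimplicialComplex V) : Set (V → ℝ) :=
  {x | x ∈ stdSimplex ℝ V ∧ ∃ s ∈ K, ∀ v, x v ≠ 0 → v ∈ s}

/-- `K` is a triangulated closed surface: its realization is a 2-dimensional topological manifold
without boundary, that is, it is covered by charts onto open subsets of the Euclidean plane. (The
realization of a finite complex is compact and metrizable, so these two properties of closed
surfaces need not be required.) -/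
def IsClosedSurface {V : Type*} [Fintype V] (K : AbstractSimplicialComplex V) : Prop :=
  Nonempty (ChartedSpace (EuclideanSpace ℝ (Fin 2)) (realization K))

/-- Connectedness of a complex, as (nonempty) connectedness of its realization. -/
def IsConnectedComplex {V : Type*} [Fintype V] (K : AbstractSimplicialComplex V) : Prop :=
  ConnectedSpace (realization K)

/-- The number of 2-faces. -/
noncomputable def numTriangles {V : Type*} (K : AbstractSimplicialComplex V) : ℕ :=
  {s : Finset V | s ∈ K ∧ s.card = 3}.ncard

/-- Simplicial isomorphism: a bijection of the vertices under which faces correspond to faces. -/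
def SimpliciallyIsomorphic {V W : Type*} (K : AbstractSimplicialComplex V)
    (L : AbstractSimplicialComplex W) : Prop :=
  ∃ e : V ≃ W, ∀ s : Finset V, s ∈ K ↔ s.map e.toEmbedding ∈ L

/-- The connected triangulated closed surfaces with `f` 2-faces whose vertices are labelled by
`Fin w`. (In an `AbstractSimplicialComplex` every element of the vertex type is a vertex, so these
have exactly `w` vertices.) -/
def LabelledSurface (f w : ℕ) : Type :=
  {K : AbstractSimplicialComplex (Fin w) //
    IsClosedSurface K ∧ IsConnectedComplex K ∧ numTriangles K = f}

/-- Simplicial isomorphism as an equivalence relation on labelled surfaces. -/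
def isoSetoid (f w : ℕ) : Setoid (LabelledSurface f w) where
  r K L := SimpliciallyIsomorphic K.1 L.1
  iseqv :=
    { refl := fun K => ⟨Equiv.refl _, fun s => by simp⟩
      symm := by
        rintro K L ⟨e, he⟩
        refine ⟨e.symm, fun s => ?_⟩
        rw [he, Finset.map_map]
        simp
      trans := by
        rintro K L M ⟨e, he⟩ ⟨e', he'⟩
        refine ⟨e.trans e', fun s => ?_⟩
        rw [he, he', Finset.map_map]
        rfl }

/-- `T f w`: the connected triangulated closed surfaces with `f` 2-faces and `w` vertices, up to
simplicial isomorphism. -/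
def T (f w : ℕ) : Type :=
  Quotient (isoSetoid f w)

/-- `T f w` is finite, so that `Nat.card (T f w)` is its actual cardinality. -/
instance (f w : ℕ) : Finite (T f w) := by
  have h1 : Finite (AbstractSimplicialComplex (Fin w)) :=
    Finite.of_injective (fun K => (K : Set (Finset (Fin w)))) SetLike.coe_injective
  have h2 : Finite (LabelledSurface f w) := Subtype.finite
  exact Quotient.finite _

end TriangulatedSurface

/-! Cut the surface along a spanning tree of its 1-skeleton. With numbered triangles, the 3f sides
are paired into 3f/2 edges, of which w - 1 belong to the tree. It is enough to record the pairing
off the tree, that is m = 3f/2 - w + 1 choices of a partner among 3f sides, and a bounded number of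
bits per side: whether it is on the tree, which end is the child, how the ends match, which side
represents its edge. The tree gluings follow by induction from the deepest vertices to the root: the
link of a vertex is a cycle, so it stays connected when cut at the parent edge (`link_avoiding`),
and going around it identifies all corners at that vertex, hence also their parents (`rel_of_eq`,
`eq_of_bits_eq`).

Recording also the three vertices of one triangle makes the labelled object rigid
(`eq_of_fixes_triangle`), so all f! numberings count separately: |T| f! ≤ 2^(12f) (3f)^m w^3
(`card_T_mul_factorial_le`). Since f! ≥ (f/e)^f and w ≤ 3f, the factor f^(3f/2) drops to f^(f/2) and
(3f)^(-w) ≤ w^(-w) remains (`count_bound`).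

The combinatorial input (two triangles on each edge, connected links, connected 1-skeleton) must be
extracted from a purely topological definition of surface. This rests on invariance of domain in the
plane, obtained from a lifting argument for the exponential, and on the connectedness of a punctured
disc. -/

namespace TriangulatedSurface

open Set Metric Filter Topology

/-! ### Invariance of domain in the plane -/

/-- A continuous map of the closed unit disc which moves boundary points by less than one unit
vanishes somewhere. -/
theorem exists_zero_of_near_id {h : ℂ → ℂ} (hc : ContinuousOn h (closedBall 0 1))
    (hb : ∀ z : ℂ, ‖z‖ = 1 → ‖h z - z‖ < 1) : ∃ z ∈ closedBall (0 : ℂ) 1, h z = 0 := by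
  by_contra! hne
  have hproj : ∀ z : ℂ, ((max 1 ‖z‖ : ℝ) : ℂ)⁻¹ * z ∈ closedBall (0 : ℂ) 1 := by
    intro z
    have : 0 < max 1 ‖z‖ := lt_max_of_lt_left one_pos
    rw [mem_closedBall_zero_iff, norm_mul, norm_inv, Complex.norm_real, Real.norm_eq_abs,
      abs_of_pos this, inv_mul_le_iff₀ this, mul_one]
    exact le_max_right _ _
  have hprojc : Continuous fun z : ℂ => ((max 1 ‖z‖ : ℝ) : ℂ)⁻¹ * z := by
    refine Continuous.mul (Continuous.inv₀ (by fun_prop) fun z => ?_) continuous_id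
    exact_mod_cast (lt_max_of_lt_left one_pos).ne'
  have hg : Continuous fun z : ℂ => h (((max 1 ‖z‖ : ℝ) : ℂ)⁻¹ * z) :=
    hc.comp_continuous hprojc hproj
  have hsc : IsSimplyConnected (univ : Set ℂ) := by
    have : ContractibleSpace (univ : Set ℂ) := convex_univ.contractibleSpace ⟨0, mem_univ _⟩
    unfold IsSimplyConnected
    infer_instance
  -- Composing with the radial retraction onto the disc gives a nowhere zero function on the whole
  -- plane, which has a continuous logarithm.
  obtain ⟨L, hLc, hL⟩ := Complex.exists_continuousOn_eqOn_exp_comp hsc isOpen_univ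
    hg.continuousOn (by
      rintro ⟨z, -, hz⟩
      exact hne _ (hproj z) hz)
  rw [continuousOn_univ] at hLc
  have hL' : ∀ z : ℂ, ‖z‖ = 1 → Complex.exp (L z) = h z := by
    intro z hz
    have := hL (mem_univ z)
    simpa [hz] using this
  let c : ℝ → ℂ := fun θ => Complex.exp (θ * Complex.I)
  have hc1 : ∀ θ, ‖c θ‖ = 1 := fun θ => Complex.norm_exp_ofReal_mul_I θ
  have hc0 : ∀ θ, c θ ≠ 0 := fun θ => Complex.exp_ne_zero _
  have hcc : Continuous c := by fun_prop
  have hslit : ∀ θ, h (c θ) / c θ ∈ Complex.slitPlane := by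
    intro θ
    refine Complex.mem_slitPlane_of_norm_lt_one (z := h (c θ) / c θ - 1) ?_ |> fun H => by
      simpa using H
    rw [div_sub_one (hc0 θ), norm_div, hc1, div_one]
    exact hb _ (hc1 θ)
  have hhc : Continuous fun θ => h (c θ) :=
    hc.comp_continuous hcc fun θ => by simp [hc1]
  -- On the circle `h z / z` stays within distance one of 1, so its principal logarithm is
  -- continuous. Then `ψ` is continuous with values in 2πiℤ, hence constant, while its last term
  -- changes by 2πi over one turn.
  let ψ : ℝ → ℂ := fun θ => L (c θ) - Complex.log (h (c θ) / c θ) - θ * Complex.I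
  have hψc : Continuous ψ := by
    refine ((hLc.comp hcc).sub ?_).sub (by fun_prop)
    exact (hhc.div hcc hc0).clog hslit
  have hψ : ∀ θ, Complex.exp (ψ θ) = 1 := by
    intro θ
    have hne' : h (c θ) ≠ 0 := hne _ (by simp [hc1])
    rw [Complex.exp_sub, Complex.exp_sub, hL' _ (hc1 θ),
      Complex.exp_log (div_ne_zero hne' (hc0 θ))]
    change h (c θ) / (h (c θ) / c θ) / c θ = 1
    field_simp [hc0 θ]
  have hconst : ∀ θ, ψ θ = ψ 0 := by
    let n : ℝ → ℝ := fun θ => (ψ θ / (2 * Real.pi * Complex.I)).re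
    have hpi : (2 * Real.pi * Complex.I : ℂ) ≠ 0 := Complex.two_pi_I_ne_zero
    have hint : ∀ θ, ∃ k : ℤ, ψ θ = k * (2 * Real.pi * Complex.I) :=
      fun θ => Complex.exp_eq_one_iff.1 (hψ θ)
    choose k hk using hint
    have hnk : ∀ θ, n θ = k θ := by
      intro θ
      simp only [n]
      rw [hk, mul_div_assoc, div_self hpi]
      simp
    have hnc : Continuous n := by fun_prop
    have hkc : Continuous k := by
      have : Continuous fun θ => ((k θ : ℤ) : ℝ) := by simpa only [← hnk] using hnc
      exact Int.isClosedEmbedding_coe_real.isInducing.continuous_iff.2 this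
    intro θ
    have := PreconnectedSpace.constant inferInstance hkc (x := θ) (y := 0)
    rw [hk θ, hk 0, this]
  have h2 := hconst (2 * Real.pi)
  have hc2 : c (2 * Real.pi) = c 0 := by simp [c, Complex.exp_two_pi_mul_I]
  simp only [ψ, hc2] at h2
  have : ((2 * Real.pi : ℝ) : ℂ) * Complex.I = 0 := by
    have h3 := sub_right_injective h2
    simp at h3
  simp at this

/-- Extend the inverse of `f` to the plane by Tietze. If the centre had an image outside the
interior, the image could be pushed off a small disc around a nearby missed point `c`, and a
perturbed inverse would have no zero on the pushed image. Composed with `f` it would be close to the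
identity on the circle, against `exists_zero_of_near_id`. -/
theorem mem_interior_image_closedBall {f : ℂ → ℂ} (hc : ContinuousOn f (closedBall 0 1))
    (hi : InjOn f (closedBall 0 1)) : f 0 ∈ interior (f '' closedBall 0 1) := by
  by_contra hint
  let D := closedBall (0 : ℂ) 1
  have hDc : IsCompact D := isCompact_closedBall _ _
  have hK : IsCompact (f '' D) := hDc.image_of_continuousOn hc
  have : CompactSpace D := isCompact_iff_compactSpace.1 hDc
  have he : IsClosedEmbedding (D.domRestrict f) :=
    Continuous.isClosedEmbedding (continuousOn_iff_continuous_domRestrict.1 hc)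
      (injOn_iff_injective.1 hi)
  obtain ⟨G, hG⟩ := ContinuousMap.exists_extension (Y := ℂ) he
    ⟨((↑) : D → ℂ), continuous_subtype_val⟩
  have hGf : ∀ z ∈ D, G (f z) = z := fun z hz => congr($hG ⟨z, hz⟩)
  have h0D : (0 : ℂ) ∈ D := by simp [D]
  have hG0 : G (f 0) = 0 := hGf 0 h0D
  obtain ⟨ε, hε, hGε⟩ : ∃ ε > 0, ∀ y, dist y (f 0) < 2 * ε → ‖G y‖ < 1 / 10 := by
    obtain ⟨δ, hδ, h⟩ := Metric.continuousAt_iff.1 (G.continuous.continuousAt (x := f 0)) (1 / 10)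
      (by norm_num)
    refine ⟨δ / 2, by positivity, fun y hy => ?_⟩
    have := h (x := y) (by linarith)
    rwa [hG0, dist_zero_right] at this
  obtain ⟨c, hcK, hcε⟩ : ∃ c, c ∉ f '' D ∧ dist c (f 0) < ε := by
    by_contra! H
    apply hint
    rw [mem_interior_iff_mem_nhds, Metric.mem_nhds_iff]
    refine ⟨ε, hε, fun y hy => ?_⟩
    by_contra hy'
    exact absurd (H y hy') (not_le.2 hy)
  let A : Set ℂ := f '' D ∩ {y | ε ≤ dist y c}
  have hA : IsCompact A := hK.inter_right (isClosed_le continuous_const (by fun_prop))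
  obtain ⟨η, hη, hη'⟩ : ∃ η > 0, ∀ y ∈ A, 2 * η ≤ ‖G y‖ := by
    rcases A.eq_empty_or_nonempty with hAe | hAn
    · exact ⟨1, one_pos, by simp [hAe]⟩
    · obtain ⟨y₀, hy₀, hmin⟩ := hA.exists_isMinOn hAn (f := fun y => ‖G y‖) (by fun_prop)
      refine ⟨‖G y₀‖ / 2, half_pos (norm_pos_iff.2 ?_), fun y hy => ?_⟩
      · obtain ⟨⟨z, hz, rfl⟩, hy₀'⟩ := hy₀
        rw [hGf z hz]
        rintro rfl
        rw [mem_ofPred_eq, dist_comm] at hy₀'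
        linarith
      · have : ‖G y₀‖ ≤ ‖G y‖ := hmin hy
        linarith
  let η' := min η (1 / 10)
  have hη'0 : 0 < η' := lt_min hη (by norm_num)
  obtain ⟨P, hPd, hP, -⟩ := G.continuous.exists_contDiff_approx 1 (ε := fun _ => η' / 2)
    continuous_const (fun _ => by positivity)
  have hcirc : ContDiff ℝ 1 fun θ : ℝ => P (c + ε * Complex.exp (θ * Complex.I)) := by
    refine hPd.comp (contDiff_const.add (contDiff_const.mul ?_))
    exact Complex.contDiff_exp.comp (Complex.ofRealCLM.contDiff.mul contDiff_const)
  -- The image of a C¹ curve has dense complement in the plane, so subtracting a small constant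
  -- removes the zeros of `P` on the circle of radius `ε` about `c`.
  obtain ⟨a, ha, haη⟩ : ∃ a, a ∉ range (fun θ : ℝ => P (c + ε * Complex.exp (θ * Complex.I))) ∧
      ‖a‖ < η' / 2 := by
    have hd := hcirc.dense_compl_range_of_finrank_lt_finrank (by simp [Complex.finrank_real_complex])
    obtain ⟨a, ha, haη⟩ := hd.exists_dist_lt 0 (half_pos hη'0)
    exact ⟨a, ha, by simpa using haη⟩
  let Q : ℂ → ℂ := fun y => P y - a
  have hQG : ∀ y, ‖Q y - G y‖ < η' := by
    intro y
    have h1 := hP y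
    rw [dist_eq_norm] at h1
    calc ‖Q y - G y‖ = ‖(P y - G y) - a‖ := by simp only [Q]; ring_nf
      _ ≤ ‖P y - G y‖ + ‖a‖ := norm_sub_le _ _
      _ < η' := by linarith
  have hQcirc : ∀ y, dist y c = ε → Q y ≠ 0 := by
    intro y hy h0
    apply ha
    refine ⟨(y - c).arg, ?_⟩
    have h1 : (ε : ℂ) * Complex.exp ((y - c).arg * Complex.I) = y - c := by
      rw [← hy, dist_eq_norm]
      exact Complex.norm_mul_exp_arg_mul_I _
    simp only
    rw [h1, add_sub_cancel]
    exact sub_eq_zero.1 h0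
  have hQA : ∀ y ∈ A, Q y ≠ 0 := by
    intro y hy h0
    have h1 := hQG y
    rw [h0, zero_sub, norm_neg] at h1
    have h2 := hη' y hy
    have : η' ≤ η := min_le_left _ _
    linarith
  -- Radial push out of the disc about `c`, defined on the image because `c` is missed. It lands
  -- either in `A` or on the circle, where `Q` does not vanish.
  let Φ : ℂ → ℂ := fun y => c + ((max (ε / dist y c) 1 : ℝ) : ℂ) * (y - c)
  have hΦc : ContinuousOn Φ (f '' D) := by
    have : ContinuousOn (fun y => ε / dist y c) (f '' D) := by
      refine continuousOn_const.div (by fun_prop) fun y hy => ?_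
      rw [dist_ne_zero]
      rintro rfl
      exact hcK hy
    refine continuousOn_const.add (ContinuousOn.mul ?_ (by fun_prop))
    exact Complex.continuous_ofReal.comp_continuousOn (ContinuousOn.sup this continuousOn_const)
  have hΦfar : ∀ y, ε ≤ dist y c → Φ y = y := by
    intro y hy
    have : ε / dist y c ≤ 1 := (div_le_one (hε.trans_le hy)).2 hy
    simp [Φ, max_eq_right this]
  have hΦnear : ∀ y ∈ f '' D, dist y c < ε → dist (Φ y) c = ε := by
    intro y hy hlt
    have h0 : 0 < dist y c := dist_pos.2 (by rintro rfl; exact hcK hy)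
    have h1 : 1 ≤ ε / dist y c := (one_le_div h0).2 hlt.le
    have : dist (Φ y) c = ε / dist y c * dist y c := by
      rw [dist_eq_norm, dist_eq_norm]
      simp only [Φ, add_sub_cancel_left]
      rw [← dist_eq_norm, max_eq_left h1, norm_mul, Complex.norm_real, Real.norm_eq_abs,
        abs_of_pos (by linarith), dist_eq_norm]
    rw [this, div_mul_cancel₀ _ h0.ne']
  have hη'10 : η' ≤ 1 / 10 := min_le_right _ _
  obtain ⟨z, hz, hz0⟩ := exists_zero_of_near_id (h := fun z => Q (Φ (f z)))
    ((hPd.continuous.sub continuous_const).comp_continuousOn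
      (hΦc.comp hc (mapsTo_image _ _))) (by
    intro z hz
    have hzD : z ∈ D := by simp [D, hz]
    have h1 := hQG (Φ (f z))
    by_cases hy : ε ≤ dist (f z) c
    · rw [hΦfar _ hy, hGf z hzD] at h1
      simp only [hΦfar _ hy]
      linarith
    · push Not at hy
      have h2 := hΦnear _ (mem_image_of_mem f hzD) hy
      have h3 : ‖G (Φ (f z))‖ < 1 / 10 := hGε _ (by
        linarith [dist_triangle (Φ (f z)) c (f 0)])
      -- Boundary points never come this near: `G (f z) = z` has norm one.
      have h4 : ‖G (f z)‖ < 1 / 10 := hGε _ (by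
        linarith [dist_triangle (f z) c (f 0)])
      rw [hGf z hzD] at h4
      linarith)
  by_cases hy : ε ≤ dist (f z) c
  · rw [hΦfar _ hy] at hz0
    exact hQA _ ⟨mem_image_of_mem f hz, hy⟩ hz0
  · push Not at hy
    exact hQcirc _ (hΦnear _ (mem_image_of_mem f hz) hy) hz0

/-- Invariance of domain in the plane. -/
theorem isOpen_image_of_injOn {U : Set ℂ} (hU : IsOpen U) {f : ℂ → ℂ} (hc : ContinuousOn f U)
    (hi : InjOn f U) : IsOpen (f '' U) := by
  rw [isOpen_iff_mem_nhds]
  rintro _ ⟨z, hz, rfl⟩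
  obtain ⟨r, hr, hrU⟩ := Metric.nhds_basis_closedBall.mem_iff.1 (hU.mem_nhds hz)
  have hmaps : MapsTo (fun w : ℂ => z + r * w) (closedBall 0 1) U := by
    intro w hw
    apply hrU
    rw [mem_closedBall_zero_iff] at hw
    rw [mem_closedBall, dist_eq_norm, add_sub_cancel_left, norm_mul, Complex.norm_real,
      Real.norm_eq_abs, abs_of_pos hr]
    nlinarith
  have h := mem_interior_image_closedBall (f := fun w => f (z + r * w))
    (hc.comp (by fun_prop) hmaps) (by
      intro w hw w' hw' hww'
      have := hi (hmaps hw) (hmaps hw') hww'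
      have hr' : (r : ℂ) ≠ 0 := by exact_mod_cast hr.ne'
      simpa [hr'] using this)
  simp only [mul_zero, add_zero] at h
  refine mem_of_superset (mem_interior_iff_mem_nhds.1 h) ?_
  rintro _ ⟨w, hw, rfl⟩
  exact mem_image_of_mem f (hmaps hw)

end TriangulatedSurface

namespace TriangulatedSurface

open Set Metric Filter Topology

/-! ### Spaces locally homeomorphic to the plane -/

/-- Every point lies in the domain of a chart with values in the plane. -/
def LocallyPlanar (X : Type*) [TopologicalSpace X] : Prop :=
  ∀ x : X, ∃ e : OpenPartialHomeomorph X ℂ, x ∈ e.source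

theorem IsClosedSurface.locallyPlanar {V : Type*} [Fintype V] {K : AbstractSimplicialComplex V}
    (hK : IsClosedSurface K) : LocallyPlanar (realization K) := by
  obtain ⟨hK⟩ := hK
  intro x
  refine ⟨(chartAt (EuclideanSpace ℝ (Fin 2)) x).transHomeomorph
    Complex.orthonormalBasisOneI.repr.symm.toHomeomorph, ?_⟩
  simp

namespace LocallyPlanar

section Space

variable {X : Type*} [TopologicalSpace X]

/-- Invariance of domain read through a chart. It forces an embedded disc to fill a neighbourhood,
which excludes branching. -/
theorem isOpen_image_into (hX : LocallyPlanar X) {U : Set ℂ} (hU : IsOpen U) {g : ℂ → X}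
    (hc : ContinuousOn g U) (hi : InjOn g U) : IsOpen (g '' U) := by
  rw [isOpen_iff_mem_nhds]
  rintro _ ⟨z, hz, rfl⟩
  obtain ⟨e, he⟩ := hX (g z)
  have hU' : IsOpen (U ∩ g ⁻¹' e.source) := hc.isOpen_inter_preimage hU e.open_source
  have hopen : IsOpen (e ∘ g '' (U ∩ g ⁻¹' e.source)) := by
    refine isOpen_image_of_injOn hU' ?_ ?_
    · exact e.continuousOn.comp (hc.mono inter_subset_left) fun w hw => hw.2
    · exact e.injOn.comp (hi.mono inter_subset_left) fun w hw => hw.2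
  have h2 : IsOpen (e.source ∩ e ⁻¹' (e ∘ g '' (U ∩ g ⁻¹' e.source))) :=
    e.isOpen_inter_preimage hopen
  refine mem_of_superset (h2.mem_nhds ⟨he, z, ⟨hz, he⟩, rfl⟩) ?_
  rintro y ⟨hy, w, ⟨hw, hw'⟩, hwy⟩
  exact ⟨w, hw, e.injOn hw' hy hwy⟩

/-- The same in the opposite direction; it excludes boundary points. -/
theorem isOpen_image_from (hX : LocallyPlanar X) {W : Set X} (hW : IsOpen W) {φ : X → ℂ}
    (hc : ContinuousOn φ W) (hi : InjOn φ W) : IsOpen (φ '' W) := by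
  rw [isOpen_iff_mem_nhds]
  rintro _ ⟨x, hx, rfl⟩
  obtain ⟨e, he⟩ := hX x
  have hO : IsOpen (e.target ∩ e.symm ⁻¹' W) := e.symm.isOpen_inter_preimage hW
  have hopen : IsOpen (φ ∘ e.symm '' (e.target ∩ e.symm ⁻¹' W)) := by
    refine isOpen_image_of_injOn hO ?_ ?_
    · exact hc.comp (e.symm.continuousOn.mono inter_subset_left) fun w hw => hw.2
    · exact hi.comp (e.symm.injOn.mono inter_subset_left) fun w hw => hw.2
  refine mem_of_superset (hopen.mem_nhds ⟨e x, ⟨e.map_source he, ?_⟩, ?_⟩) ?_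
  · simpa [e.left_inv he] using hx
  · simp [e.left_inv he]
  · rintro _ ⟨w, hw, rfl⟩
    exact mem_image_of_mem φ hw.2

theorem isPreconnected_ball_diff_center (c : ℂ) (r : ℝ) : IsPreconnected (ball c r \ {c}) := by
  have hs : IsPreconnected (sphere (0 : ℂ) 1) :=
    isPreconnected_sphere (by simp [Complex.rank_real_complex]) _ _
  have h : IsPreconnected ((fun p : ℝ × ℂ => c + p.1 * p.2) '' (Ioo 0 r ×ˢ sphere 0 1)) :=
    (isPreconnected_Ioo.prod hs).image _ (by fun_prop)
  convert h using 1
  ext z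
  constructor
  · rintro ⟨hz, hzc⟩
    have hne : z - c ≠ 0 := sub_ne_zero.2 hzc
    have h0 : 0 < ‖z - c‖ := norm_pos_iff.2 hne
    refine ⟨(‖z - c‖, (‖z - c‖ : ℂ)⁻¹ * (z - c)), ⟨⟨h0, ?_⟩, ?_⟩, ?_⟩
    · rwa [mem_ball, dist_eq_norm] at hz
    · simp [h0.ne']
    · have : (‖z - c‖ : ℂ) ≠ 0 := by exact_mod_cast h0.ne'
      field_simp
      ring
  · rintro ⟨⟨t, u⟩, ⟨⟨ht, htr⟩, hu⟩, rfl⟩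
    simp only [mem_sphere_iff_norm, sub_zero] at hu ht htr
    refine ⟨?_, ?_⟩
    · simp [dist_eq_norm, hu, abs_of_pos ht, htr]
    · have : u ≠ 0 := by rintro rfl; simp at hu
      simp [ht.ne', this]

/-- Pull back a punctured disc through a chart. This is what excludes pinched vertices. -/
theorem exists_isOpen_isPreconnected_diff (hX : LocallyPlanar X) {W : Set X} (hW : IsOpen W)
    {x : X} (hx : x ∈ W) :
    ∃ O, IsOpen O ∧ x ∈ O ∧ O ⊆ W ∧ IsPreconnected (O \ {x}) := by
  obtain ⟨e, he⟩ := hX x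
  have hO : IsOpen (e.target ∩ e.symm ⁻¹' W) := e.symm.isOpen_inter_preimage hW
  have hex : e x ∈ e.target ∩ e.symm ⁻¹' W := ⟨e.map_source he, by simpa [e.left_inv he] using hx⟩
  obtain ⟨r, hr, hrW⟩ := Metric.isOpen_iff.1 hO _ hex
  have hrt : ball (e x) r ⊆ e.target := hrW.trans inter_subset_left
  have hinj : InjOn e.symm (ball (e x) r) := e.symm.injOn.mono hrt
  refine ⟨e.symm '' ball (e x) r, e.symm.isOpen_image_of_subset_source isOpen_ball hrt,
    ⟨e x, mem_ball_self hr, e.left_inv he⟩, ?_, ?_⟩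
  · rintro _ ⟨z, hz, rfl⟩
    exact (hrW hz).2
  · have : e.symm '' ball (e x) r \ {x} = e.symm '' (ball (e x) r \ {e x}) := by
      rw [hinj.image_sdiff_subset (by simpa using hr)]
      simp [e.left_inv he]
    rw [this]
    exact (isPreconnected_ball_diff_center _ _).image _
      (e.symm.continuousOn.mono (sdiff_subset.trans hrt))

end Space

variable {E : Type*} [TopologicalSpace E] {S : Set E}

theorem exists_isOpen_inter_subset_image (hS : LocallyPlanar S) {U : Set ℂ} (hU : IsOpen U)
    {g : ℂ → E} (hc : ContinuousOn g U) (hi : InjOn g U) (hm : MapsTo g U S) {z : ℂ}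
    (hz : z ∈ U) : ∃ O, IsOpen O ∧ g z ∈ O ∧ O ∩ S ⊆ g '' U := by
  classical
  -- The value off `S` is a dummy; only points of `U` matter.
  let g' : ℂ → S := fun w => if h : g w ∈ S then ⟨g w, h⟩ else ⟨g z, hm hz⟩
  have hg' : ∀ w ∈ U, (g' w : E) = g w := fun w hw => by simp [g', hm hw]
  have hc' : ContinuousOn g' U := by
    rw [Topology.IsInducing.subtypeVal.continuousOn_iff]
    exact hc.congr hg'
  have hi' : InjOn g' U := by
    intro w hw w' hw' h
    apply hi hw hw'
    rw [← hg' w hw, ← hg' w' hw', h]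
  obtain ⟨O, hO, hOeq⟩ := isOpen_induced_iff.1 (hS.isOpen_image_into hU hc' hi')
  refine ⟨O, hO, ?_, ?_⟩
  · have : g' z ∈ ((↑) : S → E) ⁻¹' O := hOeq ▸ mem_image_of_mem g' hz
    rwa [mem_preimage, hg' z hz] at this
  · rintro y ⟨hyO, hyS⟩
    have : (⟨y, hyS⟩ : S) ∈ g' '' U := hOeq ▸ hyO
    obtain ⟨w, hw, hwy⟩ := this
    exact ⟨w, hw, by rw [← hg' w hw, hwy]⟩

theorem isOpen_image_inter (hS : LocallyPlanar S) {O : Set E} (hO : IsOpen O) {φ : E → ℂ}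
    (hc : Continuous φ) (hi : InjOn φ (O ∩ S)) : IsOpen (φ '' (O ∩ S)) := by
  have h := hS.isOpen_image_from (hO.preimage continuous_subtype_val) (φ := φ ∘ (↑))
    (hc.comp continuous_subtype_val).continuousOn (by
      rintro ⟨x, hx⟩ hxO ⟨y, hy⟩ hyO hxy
      exact Subtype.ext (hi ⟨hxO, hx⟩ ⟨hyO, hy⟩ hxy))
  convert h using 1
  rw [image_comp]
  congr 1
  ext x
  simp [and_comm]

theorem exists_isOpen_forall_eq (hS : LocallyPlanar S) {O : Set E} (hO : IsOpen O) {x : E}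
    (hx : x ∈ O ∩ S) {h : E → ℝ} (hc : ContinuousOn h ((O ∩ S) \ {x}))
    (h01 : ∀ y ∈ (O ∩ S) \ {x}, h y = 0 ∨ h y = 1) :
    ∃ O', IsOpen O' ∧ x ∈ O' ∧ ∀ y ∈ (O' ∩ S) \ {x}, ∀ z ∈ (O' ∩ S) \ {x}, h y = h z := by
  obtain ⟨W, hW, hxW, hWO, hpc⟩ := hS.exists_isOpen_isPreconnected_diff
    (hO.preimage continuous_subtype_val) (x := ⟨x, hx.2⟩) hx.1
  obtain ⟨O', hO', rfl⟩ := isOpen_induced_iff.1 hW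
  refine ⟨O', hO', hxW, ?_⟩
  have himg : ((↑) : S → E) '' (((↑) : S → E) ⁻¹' O' \ {⟨x, hx.2⟩}) = (O' ∩ S) \ {x} := by
    ext y
    simp only [mem_image, Set.mem_sdiff, mem_preimage, mem_singleton_iff, Subtype.exists,
      Subtype.mk.injEq, mem_inter_iff]
    constructor
    · rintro ⟨a, ha, ⟨h1, h2⟩, rfl⟩
      exact ⟨⟨h1, ha⟩, h2⟩
    · rintro ⟨⟨h1, ha⟩, h2⟩
      exact ⟨y, ha, ⟨h1, h2⟩, rfl⟩
  have hpc' := hpc.image _ continuous_subtype_val.continuousOn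
  rw [himg] at hpc'
  have hsub : (O' ∩ S) \ {x} ⊆ (O ∩ S) \ {x} := by
    rintro y ⟨⟨hy, hyS⟩, hyx⟩
    exact ⟨⟨hWO (a := ⟨y, hyS⟩) hy, hyS⟩, hyx⟩
  have hI := hpc'.image h (hc.mono hsub)
  have key : ∀ y ∈ (O' ∩ S) \ {x}, ∀ z ∈ (O' ∩ S) \ {x}, h y = 0 → h z = 1 → False := by
    intro y hy z hz hy0 hz1
    have h2 : (1 / 2 : ℝ) ∈ Icc (h y) (h z) := by rw [hy0, hz1]; norm_num
    obtain ⟨u, hu, hu'⟩ := hI.ordConnected.out (mem_image_of_mem h hy) (mem_image_of_mem h hz) h2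
    rcases h01 u (hsub hu) with h1 | h1 <;> rw [h1] at hu' <;> norm_num at hu'
  intro y hy z hz
  rcases h01 y (hsub hy) with h1 | h1 <;> rcases h01 z (hsub hz) with h2 | h2
  · rw [h1, h2]
  · exact (key y hy z hz h1 h2).elim
  · exact (key z hz y hy h2 h1).elim
  · rw [h1, h2]

end LocallyPlanar

end TriangulatedSurface

namespace TriangulatedSurface

open Set Metric Filter Topology

/-! ### The local structure of a triangulated closed surface -/

section Realization

theorem mem_of_subset_of_mem {V : Type*} {K : AbstractSimplicialComplex V} {s t : Finset V} (ht : t ∈ K) (hst : s ⊆ t)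
    (hs : s.Nonempty) : s ∈ K :=
  (K.isRelLowerSet_faces ht).2 hst hs

variable {V : Type*} [Fintype V] {K : AbstractSimplicialComplex V}

/-- The image of `φ` is open in the plane, so it cannot touch the edge of a half-plane that contains
it. -/
theorem LocallyPlanar.not_boundary {E : Type*} [TopologicalSpace E] {S : Set E}
    (hS : LocallyPlanar S) {O : Set E} (hO : IsOpen O) {φ : E → ℂ} (hc : Continuous φ)
    (hi : InjOn φ (O ∩ S)) (him : ∀ x ∈ O ∩ S, 0 ≤ (φ x).im) {m : E} (hm : m ∈ O ∩ S) :
    (φ m).im ≠ 0 := by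
  intro h0
  obtain ⟨r, hr, hball⟩ := Metric.isOpen_iff.1 (hS.isOpen_image_inter hO hc hi) _
    (mem_image_of_mem φ hm)
  have : φ m - (r / 2 : ℝ) * Complex.I ∈ ball (φ m) r := by
    simp [abs_of_pos hr, hr]
  obtain ⟨x, hx, hxe⟩ := hball this
  have h1 := him x hx
  rw [hxe] at h1
  simp [h0] at h1
  linarith

theorem mem_realization {x : V → ℝ} {s : Finset V} (hs : s ∈ K) (h0 : ∀ v, 0 ≤ x v)
    (h1 : ∑ v, x v = 1) (hsupp : ∀ v ∉ s, x v = 0) : x ∈ realization K :=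
  ⟨⟨h0, h1⟩, s, hs, fun v hv => by_contra fun h => hv (hsupp v h)⟩

variable [DecidableEq V]

theorem single_mem_realization (v : V) : Pi.single v (1 : ℝ) ∈ realization K := by
  refine mem_realization (K.singleton_mem v) (fun u => ?_) (by simp) (fun u hu => ?_)
  · by_cases h : u = v <;> simp [h]
  · simp only [Finset.mem_singleton] at hu
    simp [hu]

/-- A disc embedded in the realization is a neighbourhood of its centre, so that the centre is no
limit of points with an additional nonzero coordinate. -/
theorem LocallyPlanar.not_branching (hS : LocallyPlanar (realization K)) {U : Set ℂ}
    (hU : IsOpen U) {g : ℂ → V → ℝ} (hc : ContinuousOn g U) (hi : InjOn g U)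
    (hm : MapsTo g U (realization K)) {z : ℂ} (hz : z ∈ U) {a d : V} {s : Finset V}
    (hs : s ∈ K) (has : a ∈ s) (hds : d ∈ s) (hsupp : ∀ v ∉ s, g z v = 0) (had : a ≠ d)
    (ha : 0 < g z a) : ∃ w ∈ U, g w d ≠ 0 := by
  by_contra! hd
  obtain ⟨O, hO, hzO, hsub⟩ := hS.exists_isOpen_inter_subset_image hU hc hi hm hz
  -- Moving mass `ε` from `a` to `d` stays in the face `s` and near `g z`, but gives a nonzero
  -- `d`-coordinate.
  let γ : ℝ → V → ℝ := fun ε => g z + ε • (Pi.single d 1 - Pi.single a 1)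
  have hγ : Continuous γ := by fun_prop
  have hγ0 : γ 0 = g z := by simp [γ]
  have h1 : ∀ᶠ ε in 𝓝[>] (0 : ℝ), γ ε ∈ O :=
    nhdsWithin_le_nhds (hγ.continuousAt.eventually_mem (hO.mem_nhds (hγ0 ▸ hzO)))
  have h2 : ∀ᶠ ε in 𝓝[>] (0 : ℝ), ε < g z a := nhdsWithin_le_nhds (gt_mem_nhds ha)
  obtain ⟨ε, ⟨hεO, hεa⟩, hε⟩ := ((h1.and h2).and self_mem_nhdsWithin).exists
  have hS' : γ ε ∈ realization K := by
    obtain ⟨⟨hp, hsum⟩, -⟩ := hm hz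
    refine mem_realization hs (fun v => ?_) ?_ (fun v hv => ?_)
    · by_cases hva : v = a
      · subst hva
        simp [γ, had]
        linarith
      · have := hp v
        by_cases hvd : v = d
        · subst hvd
          simp [γ, hva]
          linarith
        · simp [γ, hva, hvd]
          exact this
    · simp [γ, Finset.sum_add_distrib, ← Finset.mul_sum, hsum]
    · have hva : v ≠ a := by rintro rfl; exact hv has
      have hvd : v ≠ d := by rintro rfl; exact hv hds
      simp [γ, hva, hvd, hsupp v hv]
  obtain ⟨w, hw, hwe⟩ := hsub ⟨hεO, hS'⟩
  have h3 := hd w hw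
  have h4 := hd z hz
  rw [hwe] at h3
  simp [γ, had.symm, h4] at h3
  exact hε.ne' h3

/-- In a tetrahedron, a flat disc around the barycentre of one triangle is not a neighbourhood: one
can move towards the fourth vertex. -/
theorem LocallyPlanar.card_le_three (hS : LocallyPlanar (realization K)) {s : Finset V}
    (hs : s ∈ K) : s.card ≤ 3 := by
  by_contra! hcard
  obtain ⟨s', hs's, hs'⟩ := Finset.exists_subset_card_eq (show 4 ≤ s.card from hcard)
  obtain ⟨a, b, c, d, hab, hac, had, hbc, hbd, hcd, rfl⟩ := Finset.card_eq_four.1 hs'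
  have hK : ({a, b, c, d} : Finset V) ∈ K := mem_of_subset_of_mem hs hs's ⟨a, by simp⟩
  let g : ℂ → V → ℝ := fun z => (1 / 3 + z.re) • Pi.single a 1 + (1 / 3 + z.im) • Pi.single b 1
    + (1 / 3 - z.re - z.im) • Pi.single c 1
  have hga : ∀ z, g z a = 1 / 3 + z.re := fun z => by simp [g, hab, hac]
  have hgb : ∀ z, g z b = 1 / 3 + z.im := fun z => by simp [g, hab.symm, hbc]
  have hgc : ∀ z, g z c = 1 / 3 - z.re - z.im := fun z => by
    simp [g, hac.symm, hbc.symm]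
  have hg : ∀ z v, v ≠ a → v ≠ b → v ≠ c → g z v = 0 := fun z v h1 h2 h3 => by
    simp [g, h1, h2, h3]
  obtain ⟨w, -, hw⟩ := hS.not_branching (U := ball 0 (1 / 10)) isOpen_ball (g := g) (z := 0)
    (a := a) (d := d) (s := {a, b, c, d}) (by fun_prop)
    (fun z _ z' _ h => by
      have h1 := congr($h a)
      have h2 := congr($h b)
      rw [hga, hga] at h1
      rw [hgb, hgb] at h2
      exact Complex.ext (by linarith) (by linarith))
    (fun z hz => by
      rw [mem_ball_zero_iff] at hz
      have h1 := abs_le.1 ((Complex.abs_re_le_norm z).trans hz.le)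
      have h2 := abs_le.1 ((Complex.abs_im_le_norm z).trans hz.le)
      refine mem_realization hK (fun v => ?_) ?_ (fun v hv => ?_)
      · by_cases hva : v = a
        · rw [hva, hga]; linarith
        by_cases hvb : v = b
        · rw [hvb, hgb]; linarith
        by_cases hvc : v = c
        · rw [hvc, hgc]; linarith
        rw [hg z v hva hvb hvc]
      · simp [g, Finset.sum_add_distrib, ← Finset.mul_sum]
        ring
      · simp only [Finset.mem_insert, Finset.mem_singleton, not_or] at hv
        exact hg z v hv.1 hv.2.1 hv.2.2.1)
    (by simp) hK (by simp) (by simp)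
    (fun v hv => by
      simp only [Finset.mem_insert, Finset.mem_singleton, not_or] at hv
      exact hg 0 v hv.1 hv.2.1 hv.2.2.1)
    had (by rw [hga]; norm_num)
  exact hw (hg w d had.symm hbd.symm hcd.symm)

theorem LocallyPlanar.not_three_triangles (hS : LocallyPlanar (realization K)) {a b c c' d : V}
    (hab : a ≠ b) (hac : a ≠ c) (hbc : b ≠ c) (hac' : a ≠ c') (hbc' : b ≠ c') (had : a ≠ d)
    (hbd : b ≠ d) (hcc' : c ≠ c') (hcd : c ≠ d) (hc'd : c' ≠ d) (h1 : {a, b, c} ∈ K)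
    (h2 : {a, b, c'} ∈ K) : {a, b, d} ∉ K := by
  intro h3
  -- A disc centred at the midpoint of `ab` and folded along it: the sign of the imaginary part
  -- selects the triangle with `c` or with `c'`.
  let g : ℂ → V → ℝ := fun z => (1 / 2 + z.re - |z.im| / 2) • Pi.single a 1
    + (1 / 2 - z.re - |z.im| / 2) • Pi.single b 1 + (max z.im 0) • Pi.single c 1
    + (max (-z.im) 0) • Pi.single c' 1
  have hga : ∀ z, g z a = 1 / 2 + z.re - |z.im| / 2 := fun z => by
    simp [g, hab, hac, hac']
  have hgb : ∀ z, g z b = 1 / 2 - z.re - |z.im| / 2 := fun z => by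
    simp [g, hab.symm, hbc, hbc']
  have hgc : ∀ z, g z c = max z.im 0 := fun z => by
    simp [g, hac.symm, hbc.symm, hcc']
  have hgc' : ∀ z, g z c' = max (-z.im) 0 := fun z => by
    simp [g, hac'.symm, hbc'.symm, hcc'.symm]
  have hg : ∀ z v, v ≠ a → v ≠ b → v ≠ c → v ≠ c' → g z v = 0 := fun z v h1 h2 h3 h4 => by
    simp [g, h1, h2, h3, h4]
  have hmax : ∀ y : ℝ, max y 0 - max (-y) 0 = y := fun y => by
    rcases le_total y 0 with h | h
    · rw [max_eq_right h, max_eq_left (by linarith)]; ring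
    · rw [max_eq_left h, max_eq_right (by linarith)]; ring
  have habs : ∀ y : ℝ, max y 0 + max (-y) 0 = |y| := fun y => by
    rcases le_total y 0 with h | h
    · rw [max_eq_right h, max_eq_left (by linarith), abs_of_nonpos h]; ring
    · rw [max_eq_left h, max_eq_right (by linarith), abs_of_nonneg h]; ring
  obtain ⟨w, -, hw⟩ := hS.not_branching (U := ball 0 (1 / 10)) isOpen_ball (g := g) (z := 0)
    (a := a) (d := d) (s := {a, b, d}) (by fun_prop)
    (fun z _ z' _ h => by
      have h1 := congr($h a)
      have h3 := congr($h c)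
      have h4 := congr($h c')
      rw [hga, hga] at h1
      rw [hgc, hgc] at h3
      rw [hgc', hgc'] at h4
      have him : z.im = z'.im := by rw [← hmax z.im, ← hmax z'.im, h3, h4]
      rw [him] at h1
      exact Complex.ext (by linarith) him)
    (fun z hz => by
      rw [mem_ball_zero_iff] at hz
      have h4 := abs_le.1 ((Complex.abs_re_le_norm z).trans hz.le)
      have h5 := (Complex.abs_im_le_norm z).trans hz.le
      have hnn : ∀ v, 0 ≤ g z v := fun v => by
        by_cases hva : v = a
        · rw [hva, hga]; linarith
        by_cases hvb : v = b
        · rw [hvb, hgb]; linarith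
        by_cases hvc : v = c
        · rw [hvc, hgc]; exact le_max_right _ _
        by_cases hvc' : v = c'
        · rw [hvc', hgc']; exact le_max_right _ _
        rw [hg z v hva hvb hvc hvc']
      have hsum : ∑ v, g z v = 1 := by
        have := habs z.im
        simp [g, Finset.sum_add_distrib, ← Finset.mul_sum]
        linarith
      rcases le_total 0 z.im with h | h
      · refine mem_realization h1 hnn hsum fun v hv => ?_
        simp only [Finset.mem_insert, Finset.mem_singleton, not_or] at hv
        by_cases hvc' : v = c'
        · rw [hvc', hgc', max_eq_right (by linarith)]
        · exact hg z v hv.1 hv.2.1 hv.2.2 hvc'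
      · refine mem_realization h2 hnn hsum fun v hv => ?_
        simp only [Finset.mem_insert, Finset.mem_singleton, not_or] at hv
        by_cases hvc : v = c
        · rw [hvc, hgc, max_eq_right h]
        · exact hg z v hv.1 hv.2.1 hvc hv.2.2)
    (by simp) h3 (by simp) (by simp)
    (fun v hv => by
      simp only [Finset.mem_insert, Finset.mem_singleton, not_or] at hv
      by_cases hvc : v = c
      · rw [hvc, hgc]; simp
      by_cases hvc' : v = c'
      · rw [hvc', hgc']; simp
      exact hg 0 v hv.1 hv.2.1 hvc hvc')
    had (by rw [hga]; norm_num)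
  exact hw (hg w d had.symm hbd.symm hcd.symm hc'd.symm)

/-- Otherwise, near the midpoint of `ab`, the coordinates `x a` and `1 - x a - x b` embed the
realization in a half-plane with the midpoint on its boundary. Since `c` is arbitrary, this covers
edges in one triangle and edges in none. -/
theorem LocallyPlanar.exists_face_not_subset (hS : LocallyPlanar (realization K)) {a b : V}
    (hab : a ≠ b) (hK : {a, b} ∈ K) (c : V) :
    ∃ s ∈ K, a ∈ s ∧ b ∈ s ∧ ¬ s ⊆ {a, b, c} := by
  by_contra! H
  let O : Set (V → ℝ) := {x | 0 < x a} ∩ {x | 0 < x b}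
  have hO : IsOpen O :=
    (isOpen_lt continuous_const (continuous_apply a)).inter
      (isOpen_lt continuous_const (continuous_apply b))
  have hsupp : ∀ x ∈ O ∩ realization K, ∀ v, v ≠ a → v ≠ b → v ≠ c → x v = 0 := by
    rintro x ⟨⟨hxa, hxb⟩, -, s, hs, hxs⟩ v hva hvb hvc
    by_contra hv
    have := H s hs (hxs a hxa.ne') (hxs b hxb.ne') (hxs v hv)
    simp [hva, hvb, hvc] at this
  let m : V → ℝ := (1 / 2 : ℝ) • Pi.single a 1 + (1 / 2 : ℝ) • Pi.single b 1
  have hma : m a = 1 / 2 := by simp [m, hab]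
  have hmb : m b = 1 / 2 := by simp [m, hab.symm]
  have hm : ∀ v, v ≠ a → v ≠ b → m v = 0 := fun v h1 h2 => by simp [m, h1, h2]
  refine hS.not_boundary hO (φ := fun x => ⟨x a, 1 - x a - x b⟩) (m := m) ?_ ?_ ?_ ?_ ?_
  · have : (fun x : V → ℝ => (⟨x a, 1 - x a - x b⟩ : ℂ)) =
        fun x => (x a : ℂ) + (1 - x a - x b) * Complex.I := by
      ext x
      apply Complex.ext <;> simp
    rw [this]
    fun_prop
  · intro x hx y hy hxy
    simp only [Complex.mk.injEq] at hxy
    have hne : ∀ v, v ≠ c ∨ v = a ∨ v = b → x v = y v := by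
      intro v hv
      by_cases hva : v = a
      · rw [hva, hxy.1]
      by_cases hvb : v = b
      · rw [hvb]; linarith
      have hvc : v ≠ c := by tauto
      rw [hsupp x hx v hva hvb hvc, hsupp y hy v hva hvb hvc]
    funext v
    by_cases hvc : v = c
    · have h1 := hx.2.1.2
      have h2 := hy.2.1.2
      rw [← Finset.add_sum_erase _ _ (Finset.mem_univ v)] at h1 h2
      have : ∑ u ∈ Finset.univ.erase v, x u = ∑ u ∈ Finset.univ.erase v, y u :=
        Finset.sum_congr rfl fun u hu => hne u (Or.inl fun h => by simp [h, hvc] at hu)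
      linarith
    · exact hne v (Or.inl hvc)
  · rintro x ⟨-, ⟨hx0, hx1⟩, -⟩
    have : ∑ v ∈ {a, b}, x v ≤ ∑ v, x v :=
      Finset.sum_le_sum_of_subset_of_nonneg (Finset.subset_univ _) fun v _ _ => hx0 v
    rw [Finset.sum_pair hab, hx1] at this
    simp only
    linarith
  · refine ⟨⟨by simp [hma], by simp [hmb]⟩, mem_realization hK (fun v => ?_) ?_ (fun v hv => ?_)⟩
    · by_cases hva : v = a
      · rw [hva, hma]; norm_num
      by_cases hvb : v = b
      · rw [hvb, hmb]; norm_num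
      rw [hm v hva hvb]
    · simp [m, Finset.sum_add_distrib, ← Finset.mul_sum]
      norm_num
    · simp only [Finset.mem_insert, Finset.mem_singleton, not_or] at hv
      exact hm v hv.1 hv.2
  · simp only [hma, hmb]
    norm_num

/-- An isolated vertex would have a neighbourhood embedded in the real line. -/
theorem LocallyPlanar.exists_edge (hS : LocallyPlanar (realization K)) (v : V) :
    ∃ u, v ≠ u ∧ {v, u} ∈ K := by
  by_contra! H
  have hO : IsOpen {x : V → ℝ | 0 < x v} := isOpen_lt continuous_const (continuous_apply v)
  have hx : ∀ x ∈ {x : V → ℝ | 0 < x v} ∩ realization K, ∀ u ≠ v, x u = 0 := by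
    rintro x ⟨hxv, -, s, hs, hxs⟩ u huv
    by_contra hu
    refine H u huv.symm (mem_of_subset_of_mem hs ?_ ⟨v, by simp⟩)
    rw [Finset.insert_subset_iff, Finset.singleton_subset_iff]
    exact ⟨hxs v hxv.ne', hxs u hu⟩
  refine hS.not_boundary hO (φ := fun x => (x v : ℂ)) (m := Pi.single v 1) (by fun_prop)
    ?_ ?_ ⟨by simp, single_mem_realization v⟩ (by simp)
  · intro x hxm y hym hxy
    funext u
    by_cases huv : u = v
    · rw [huv]
      exact Complex.ofReal_injective hxy
    · rw [hx x hxm u huv, hx y hym u huv]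
  · intro x _
    simp

end Realization

/-- The combinatorial properties of the set `F` of triangles of a connected triangulated closed
surface: every edge lies in two triangles, vertex links are connected, and so is the
`1`-skeleton. -/
structure IsCombSurface {V : Type*} [DecidableEq V] (F : Finset (Finset V)) : Prop where
  card_eq : ∀ t ∈ F, t.card = 3
  card_edge : ∀ t ∈ F, ∀ a ∈ t, ∀ b ∈ t, a ≠ b → {t' ∈ F | a ∈ t' ∧ b ∈ t'}.card = 2
  link : ∀ v, ∀ P : Finset V → Prop,
    (∀ t ∈ F, P t → v ∈ t → ∀ u ∈ t, u ≠ v → ∀ t' ∈ F, v ∈ t' → u ∈ t' → P t') →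
    ∀ t ∈ F, v ∈ t → P t → ∀ t' ∈ F, v ∈ t' → P t'
  cover : ∀ v, ∃ t ∈ F, v ∈ t
  conn : ∀ A : Set V, (∀ t ∈ F, ∀ a ∈ t, ∀ b ∈ t, a ∈ A → b ∈ A) → ∀ a ∈ A, ∀ b, b ∈ A

/-! ### From the topology of the realization to the combinatorics of its triangles -/

section Triangles

open Classical in
/-- The triangles of a complex. -/
noncomputable def triangles {V : Type*} [Fintype V] (K : AbstractSimplicialComplex V) : Finset (Finset V) :=
  {s | s ∈ K ∧ s.card = 3}

theorem mem_triangles {V : Type*} [Fintype V] {K : AbstractSimplicialComplex V} {s : Finset V} :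
    s ∈ triangles K ↔ s ∈ K ∧ s.card = 3 := by
  simp [triangles]

theorem card_triangles {V : Type*} [Fintype V] (K : AbstractSimplicialComplex V) :
    (triangles K).card = numTriangles K := by
  rw [numTriangles, ← Set.ncard_coe_finset]
  congr 1
  ext s
  simp [mem_triangles]

variable {V : Type*} [DecidableEq V]

theorem exists_eq_triple {t : Finset V} (ht : t.card = 3) {a b : V} (ha : a ∈ t) (hb : b ∈ t)
    (hab : a ≠ b) : ∃ c, a ≠ c ∧ b ≠ c ∧ t = {a, b, c} := by
  have hsub : ({a, b} : Finset V) ⊆ t := by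
    rw [Finset.insert_subset_iff, Finset.singleton_subset_iff]
    exact ⟨ha, hb⟩
  have h1 : (t \ {a, b}).card = 1 := by
    rw [Finset.card_sdiff_of_subset hsub, ht, Finset.card_pair hab]
  obtain ⟨c, hc⟩ := Finset.card_eq_one.1 h1
  have hct : c ∈ t \ {a, b} := by rw [hc]; simp
  simp only [Finset.mem_sdiff, Finset.mem_insert, Finset.mem_singleton, not_or] at hct
  refine ⟨c, Ne.symm hct.2.1, Ne.symm hct.2.2, ?_⟩
  rw [← Finset.sdiff_union_of_subset hsub, hc]
  ext x
  simp only [Finset.mem_union, Finset.mem_insert, Finset.mem_singleton]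
  tauto

variable [Fintype V] {K : AbstractSimplicialComplex V}

theorem LocallyPlanar.card_triangles_edge (hS : LocallyPlanar (realization K)) {a b : V}
    (hab : a ≠ b) (hK : {a, b} ∈ K) : {t ∈ triangles K | a ∈ t ∧ b ∈ t}.card = 2 := by
  apply le_antisymm
  · by_contra! h
    obtain ⟨t₁, h1, t₂, h2, t₃, h3, h12, h13, h23⟩ := Finset.two_lt_card.1 h
    simp only [Finset.mem_filter, mem_triangles] at h1 h2 h3
    obtain ⟨c₁, hac₁, hbc₁, rfl⟩ := exists_eq_triple h1.1.2 h1.2.1 h1.2.2 hab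
    obtain ⟨c₂, hac₂, hbc₂, rfl⟩ := exists_eq_triple h2.1.2 h2.2.1 h2.2.2 hab
    obtain ⟨c₃, hac₃, hbc₃, rfl⟩ := exists_eq_triple h3.1.2 h3.2.1 h3.2.2 hab
    exact hS.not_three_triangles hab hac₁ hbc₁ hac₂ hbc₂ hac₃ hbc₃ (by rintro rfl; simp at h12)
      (by rintro rfl; simp at h13) (by rintro rfl; simp at h23) h1.1.1 h2.1.1 h3.1.1
  · by_contra! h
    have hle := Finset.card_le_one.1 (Nat.le_of_lt_succ h)
    simp only [Finset.mem_filter, mem_triangles] at hle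
    have key : ∀ s ∈ K, a ∈ s → b ∈ s → s = {a, b} ∨ (s ∈ K ∧ s.card = 3) ∧ a ∈ s ∧ b ∈ s := by
      intro s hs ha hb
      have hsub : ({a, b} : Finset V) ⊆ s := by
        rw [Finset.insert_subset_iff, Finset.singleton_subset_iff]
        exact ⟨ha, hb⟩
      have h2 := Finset.card_le_card hsub
      have h3 := hS.card_le_three hs
      rw [Finset.card_pair hab] at h2
      rcases (by omega : s.card = 2 ∨ s.card = 3) with h | h
      · left
        exact (Finset.eq_of_subset_of_card_le hsub (by rw [h, Finset.card_pair hab])).symm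
      · right
        exact ⟨⟨hs, h⟩, ha, hb⟩
    have hc : ∃ c, ∀ s ∈ K, a ∈ s → b ∈ s → s ⊆ {a, b, c} := by
      by_cases ht : ∃ t ∈ K, t.card = 3 ∧ a ∈ t ∧ b ∈ t
      · obtain ⟨t, htK, ht3, hat, hbt⟩ := ht
        obtain ⟨c, hac, hbc, rfl⟩ := exists_eq_triple ht3 hat hbt hab
        refine ⟨c, fun s hs ha hb => ?_⟩
        rcases key s hs ha hb with rfl | h
        · intro x; simp; tauto
        · rw [hle s h _ ⟨⟨htK, ht3⟩, hat, hbt⟩]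
      -- With no triangle on the edge, `a` serves as a dummy third vertex.
      · refine ⟨a, fun s hs ha hb => ?_⟩
        rcases key s hs ha hb with rfl | h
        · intro x; simp; tauto
        · exact (ht ⟨s, h.1.1, h.1.2, h.2⟩).elim
    obtain ⟨c, hc⟩ := hc
    obtain ⟨s, hs, ha, hb, hsc⟩ := hS.exists_face_not_subset hab hK c
    exact hsc (hc s hs ha hb)

theorem LocallyPlanar.exists_triangle_edge (hS : LocallyPlanar (realization K)) {a b : V}
    (hab : a ≠ b) (hK : {a, b} ∈ K) : ∃ t ∈ triangles K, a ∈ t ∧ b ∈ t := by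
  have h := hS.card_triangles_edge hab hK
  obtain ⟨t, ht⟩ := Finset.card_pos.1 (by rw [h]; norm_num)
  exact ⟨t, by simpa using ht⟩

theorem LocallyPlanar.exists_triangle (hS : LocallyPlanar (realization K)) (v : V) :
    ∃ t ∈ triangles K, v ∈ t := by
  obtain ⟨u, hvu, huK⟩ := hS.exists_edge v
  obtain ⟨t, ht, hv, -⟩ := hS.exists_triangle_edge hvu huK
  exact ⟨t, ht, hv⟩

theorem LocallyPlanar.exists_subset_triangle (hS : LocallyPlanar (realization K)) {s : Finset V}
    (hs : s ∈ K) : ∃ t ∈ triangles K, s ⊆ t := by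
  have h3 := hS.card_le_three hs
  have h0 : 0 < s.card := Finset.card_pos.2 (K.isRelLowerSet_faces hs).1
  rcases (by omega : s.card = 1 ∨ s.card = 2 ∨ s.card = 3) with h | h | h
  · obtain ⟨v, rfl⟩ := Finset.card_eq_one.1 h
    obtain ⟨t, ht, hv⟩ := hS.exists_triangle v
    exact ⟨t, ht, by simpa using hv⟩
  · obtain ⟨a, b, hab, rfl⟩ := Finset.card_eq_two.1 h
    obtain ⟨t, ht, ha, hb⟩ := hS.exists_triangle_edge hab hs
    refine ⟨t, ht, ?_⟩
    rw [Finset.insert_subset_iff, Finset.singleton_subset_iff]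
    exact ⟨ha, hb⟩
  · exact ⟨s, mem_triangles.2 ⟨hs, h⟩, Finset.Subset.refl _⟩

theorem LocallyPlanar.mem_iff_exists_triangle (hS : LocallyPlanar (realization K))
    {s : Finset V} : s ∈ K ↔ s.Nonempty ∧ ∃ t ∈ triangles K, s ⊆ t :=
  ⟨fun hs => ⟨(K.isRelLowerSet_faces hs).1, hS.exists_subset_triangle hs⟩,
    fun ⟨hne, _, ht, hst⟩ => mem_of_subset_of_mem (mem_triangles.1 ht).1 hst hne⟩

/-- Near `v`, the share `h` of the mass off `v` that lies on vertices of `P`-triangles is continuous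
away from `v`. It is 1 on triangles with `P` and 0 on the others, because `P` passes across edges at
`v`. A punctured neighbourhood being connected, both kinds cannot occur. -/
theorem LocallyPlanar.link_connected (hS : LocallyPlanar (realization K)) (v : V)
    (P : Finset V → Prop)
    (hP : ∀ t ∈ triangles K, P t → v ∈ t → ∀ u ∈ t, u ≠ v → ∀ t' ∈ triangles K, v ∈ t' →
      u ∈ t' → P t') {t t' : Finset V} (ht : t ∈ triangles K) (hvt : v ∈ t) (hPt : P t)
    (ht' : t' ∈ triangles K) (hvt' : v ∈ t') : P t' := by
  classical
  by_contra hPt'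
  let L : Finset V := {u | u ≠ v ∧ ∃ t ∈ triangles K, P t ∧ v ∈ t ∧ u ∈ t}
  let h : (V → ℝ) → ℝ := fun x => (∑ u ∈ L, x u) / (1 - x v)
  have hO : IsOpen {x : V → ℝ | 0 < x v} := isOpen_lt continuous_const (continuous_apply v)
  have hin : ∀ s ∈ triangles K, v ∈ s → P s → ∀ u ∈ s, u ≠ v → u ∈ L := by
    intro s hs hvs hPs u hu huv
    simp only [L, Finset.mem_filter, Finset.mem_univ, true_and]
    exact ⟨huv, s, hs, hPs, hvs, hu⟩
  have hout : ∀ s ∈ triangles K, v ∈ s → ¬ P s → ∀ u ∈ s, u ∉ L := by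
    intro s hs hvs hPs u hu huL
    simp only [L, Finset.mem_filter, Finset.mem_univ, true_and] at huL
    obtain ⟨huv, t₁, ht₁, hPt₁, hvt₁, hut₁⟩ := huL
    exact hPs (hP t₁ ht₁ hPt₁ hvt₁ u hut₁ huv s hs hvs hu)
  have hlt : ∀ x ∈ realization K, x ≠ Pi.single v 1 → x v < 1 := by
    rintro x ⟨⟨hx0, hx1⟩, -⟩ hxv
    rw [← Finset.add_sum_erase _ _ (Finset.mem_univ v)] at hx1
    have hnn : 0 ≤ ∑ u ∈ Finset.univ.erase v, x u := Finset.sum_nonneg fun u _ => hx0 u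
    refine lt_of_le_of_ne (by linarith) fun hv1 => hxv ?_
    have h0 : ∑ u ∈ Finset.univ.erase v, x u = 0 := by linarith
    rw [Finset.sum_eq_zero_iff_of_nonneg fun u _ => hx0 u] at h0
    funext u
    by_cases huv : u = v
    · rw [huv, hv1]; simp
    · rw [h0 u (by simp [huv])]; simp [huv]
  have hval : ∀ x ∈ realization K, x ≠ Pi.single v 1 → ∀ s ∈ triangles K, v ∈ s →
      (∀ u, x u ≠ 0 → u ∈ s) → h x = if P s then 1 else 0 := by
    intro x hx hxv s hs hvs hxs
    split_ifs with hPs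
    · have h1 := hlt x hx hxv
      have : ∑ u ∈ L, x u = 1 - x v := by
        have hsum := hx.1.2
        rw [← Finset.add_sum_erase _ _ (Finset.mem_univ v)] at hsum
        have : ∑ u ∈ L, x u = ∑ u ∈ Finset.univ.erase v, x u := by
          apply Finset.sum_subset
          · intro u hu
            simp only [L, Finset.mem_filter] at hu
            simp [hu.2.1]
          · intro u hu huL
            by_contra hxu
            exact huL (hin s hs hvs hPs u (hxs u hxu) (by simpa using hu))
        linarith
      simp only [h]
      rw [this, div_self (by linarith)]
    · have : ∑ u ∈ L, x u = 0 := Finset.sum_eq_zero fun u hu => by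
        by_contra hxu
        exact hout s hs hvs hPs u (hxs u hxu) hu
      simp only [h]
      rw [this, zero_div]
  obtain ⟨O', hO', hvO', heq⟩ := hS.exists_isOpen_forall_eq hO (x := Pi.single v 1)
    ⟨by simp, single_mem_realization v⟩ (h := h) (by
      refine ContinuousOn.div (by fun_prop) (by fun_prop) ?_
      rintro x ⟨⟨-, hx⟩, hxv⟩
      linarith [hlt x hx hxv]) (by
      rintro x ⟨⟨hx0, hx⟩, hxv⟩
      obtain ⟨-, s, hs, hxs⟩ := id hx
      obtain ⟨s', hs', hss'⟩ := hS.exists_subset_triangle hs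
      rw [hval x hx hxv s' hs' (hss' (hxs v (ne_of_gt hx0))) fun u hu => hss' (hxs u hu)]
      split_ifs <;> simp)
  have hnear : ∀ s ∈ triangles K, v ∈ s → ∃ x ∈ (O' ∩ realization K) \ {Pi.single v 1},
      h x = if P s then 1 else 0 := by
    intro s hs hvs
    obtain ⟨u, hus, huv⟩ := Finset.exists_mem_ne (by
      rw [(mem_triangles.1 hs).2]; norm_num) v
    let γ : ℝ → V → ℝ := fun ε => (1 - ε) • Pi.single v 1 + ε • Pi.single u 1
    have hγ : Continuous γ := by fun_prop
    have hγ0 : γ 0 = Pi.single v 1 := by simp [γ]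
    have h1 : ∀ᶠ ε in 𝓝[>] (0 : ℝ), γ ε ∈ O' :=
      nhdsWithin_le_nhds (hγ.continuousAt.eventually_mem (hO'.mem_nhds (hγ0 ▸ hvO')))
    have h2 : ∀ᶠ ε in 𝓝[>] (0 : ℝ), ε < 1 := nhdsWithin_le_nhds (gt_mem_nhds one_pos)
    obtain ⟨ε, ⟨hεO, hε1⟩, hε⟩ := ((h1.and h2).and self_mem_nhdsWithin).exists
    have hsupp : ∀ y ∉ s, γ ε y = 0 := by
      intro y hy
      have h1 : y ≠ v := by rintro rfl; exact hy hvs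
      have h2 : y ≠ u := by rintro rfl; exact hy hus
      simp [γ, h1, h2]
    have hu : γ ε u = ε := by simp [γ, huv]
    have hv : γ ε v = 1 - ε := by simp [γ, huv.symm]
    have hR : γ ε ∈ realization K := by
      refine mem_realization (mem_triangles.1 hs).1 (fun y => ?_) ?_ hsupp
      · by_cases h1 : y = u
        · rw [h1, hu]; exact hε.le
        by_cases h2 : y = v
        · rw [h2, hv]; linarith
        simp [γ, h1, h2]
      · simp [γ, Finset.sum_add_distrib, ← Finset.mul_sum]
    have hne : γ ε ≠ Pi.single v 1 := by
      intro h
      have := congr($h u)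
      rw [hu] at this
      simp [huv] at this
      exact hε.ne' this
    exact ⟨γ ε, ⟨⟨hεO, hR⟩, hne⟩, hval _ hR hne s hs hvs fun y hy =>
      by_contra fun h => hy (hsupp y h)⟩
  obtain ⟨x, hx, hx1⟩ := hnear t ht hvt
  obtain ⟨y, hy, hy1⟩ := hnear t' ht' hvt'
  have := heq x hx y hy
  rw [hx1, hy1, if_pos hPt, if_neg hPt'] at this
  norm_num at this

/-- The total mass on `A` is a continuous function with values 0 and 1 only. -/
theorem IsConnectedComplex.mem_of_closed (hK : IsConnectedComplex K) {A : Set V}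
    (hA : ∀ s ∈ K, ∀ a ∈ s, ∀ b ∈ s, a ∈ A → b ∈ A) {a : V} (ha : a ∈ A) (b : V) : b ∈ A := by
  classical
  by_contra hb
  have : ConnectedSpace (realization K) := hK
  let h : realization K → ℝ := fun x => ∑ v with v ∈ A, (x : V → ℝ) v
  have hc : Continuous h := by fun_prop
  have h01 : ∀ x, h x = 0 ∨ h x = 1 := by
    rintro ⟨x, ⟨hx0, hx1⟩, s, hs, hxs⟩
    by_cases hsA : ∃ c ∈ s, c ∈ A
    · right
      obtain ⟨c, hcs, hcA⟩ := hsA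
      simp only [h]
      rw [← hx1]
      refine Finset.sum_subset (Finset.subset_univ _) fun v _ hv => ?_
      by_contra hxv
      exact hv (by simpa using hA s hs c hcs v (hxs v hxv) hcA)
    · left
      refine Finset.sum_eq_zero fun v hv => ?_
      by_contra hxv
      exact hsA ⟨v, hxs v hxv, by simpa using hv⟩
  have h1 : h ⟨Pi.single a 1, single_mem_realization a⟩ = 1 := by
    simp [h, Finset.sum_pi_single', ha]
  have h0 : h ⟨Pi.single b 1, single_mem_realization b⟩ = 0 := by
    simp [h, Finset.sum_pi_single', hb]
  obtain ⟨x, hx⟩ := mem_range_of_exists_le_of_exists_ge hc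
    (c := 1 / 2) ⟨_, by rw [h0]; norm_num⟩ ⟨_, by rw [h1]; norm_num⟩
  rcases h01 x with h | h <;> rw [h] at hx <;> norm_num at hx

theorem isCombSurface_triangles (hK : IsClosedSurface K) (hc : IsConnectedComplex K) :
    IsCombSurface (triangles K) where
  card_eq t ht := (mem_triangles.1 ht).2
  card_edge t ht a ha b hb hab := hK.locallyPlanar.card_triangles_edge hab
    (mem_of_subset_of_mem (mem_triangles.1 ht).1
      (by rw [Finset.insert_subset_iff, Finset.singleton_subset_iff]; exact ⟨ha, hb⟩)
      ⟨a, by simp⟩)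
  link v P hP t ht hv hPt t' ht' hv' :=
    hK.locallyPlanar.link_connected v P hP ht hv hPt ht' hv'
  cover := hK.locallyPlanar.exists_triangle
  conn A hA a ha b := hc.mem_of_closed (A := A) (fun s hs x hx y hy hxA => by
    obtain ⟨t, ht, hst⟩ := hK.locallyPlanar.exists_subset_triangle hs
    exact hA t ht x (hst hx) y (hst hy) hxA) ha b

end Triangles

end TriangulatedSurface

namespace TriangulatedSurface

open Finset

/-! ### Combinatorial surfaces -/

namespace IsCombSurface

variable {V : Type*} [DecidableEq V] {F : Finset (Finset V)}

/-- A link remains connected after it is cut at one point, since it is a cycle. -/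
theorem link_avoiding [Fintype V] (hF : IsCombSurface F) (v p : V) (P : Finset V → Prop)
    (hP : ∀ t ∈ F, P t → v ∈ t → ∀ u ∈ t, u ≠ v → u ≠ p → ∀ t' ∈ F, v ∈ t' → u ∈ t' → P t') :
    ∀ t ∈ F, v ∈ t → P t → ∀ t' ∈ F, v ∈ t' → P t' := by
  classical
  refine hF.link v P fun t ht hPt hvt u hut huv t' ht' hvt' hut' => ?_
  by_cases hup : u ≠ p
  · exact hP t ht hPt hvt u hut huv hup t' ht' hvt' hut'
  push Not at hup
  subst hup
  let A : Finset (Finset V) := {s ∈ F | v ∈ s ∧ P s}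
  have hsub : ∀ x, {s ∈ A | x ∈ s} ⊆ {s ∈ F | v ∈ s ∧ x ∈ s} := by
    intro x s hs
    simp only [A, mem_filter] at hs ⊢
    exact ⟨hs.1.1, hs.1.2.1, hs.2⟩
  -- Parity: each triangle of `A` has two vertices besides `v`, and each vertex other than `u` and
  -- `v` lies in none or two triangles of `A`. So the number at `u` is even, and it is positive
  -- because of `t`; hence both triangles on `vu` satisfy `P`.
  have hcount := sum_card_bipartiteAbove_eq_sum_card_bipartiteBelow
    (s := A) (t := univ.erase v) (fun s x => x ∈ s)
  simp only [bipartiteAbove, bipartiteBelow] at hcount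
  have hleft : ∀ s ∈ A, #{x ∈ univ.erase v | x ∈ s} = 2 := by
    intro s hs
    simp only [A, mem_filter] at hs
    have : {x ∈ univ.erase v | x ∈ s} = s.erase v := by
      ext x
      simp
    rw [this, card_erase_of_mem hs.2.1, hF.card_eq s hs.1]
  rw [sum_congr rfl hleft, sum_const, smul_eq_mul,
    ← add_sum_erase _ _ (show u ∈ univ.erase v by simp [huv])] at hcount
  have heven : Even (∑ x ∈ (univ.erase v).erase u, #{s ∈ A | x ∈ s}) := by
    refine Finset.even_sum _ fun x hx => ?_
    simp only [mem_erase, mem_univ, and_true] at hx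
    rcases {s ∈ A | x ∈ s}.eq_empty_or_nonempty with h | ⟨s, hs⟩
    · simp [h]
    · have : {s ∈ A | x ∈ s} = {s ∈ F | v ∈ s ∧ x ∈ s} := by
        refine (hsub x).antisymm fun s' hs' => ?_
        simp only [A, mem_filter] at hs hs' ⊢
        exact ⟨⟨hs'.1, hs'.2.1, hP s hs.1.1 hs.1.2.2 hs.1.2.1 x hs.2 hx.2 hx.1 s' hs'.1 hs'.2.1
          hs'.2.2⟩, hs'.2.2⟩
      simp only [A, mem_filter] at hs
      rw [this, hF.card_edge s hs.1.1 v hs.1.2.1 x hs.2 (Ne.symm hx.2)]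
      exact even_two
  have heq : {s ∈ A | u ∈ s} = {s ∈ F | v ∈ s ∧ u ∈ s} := by
    refine eq_of_subset_of_card_le (hsub u) ?_
    rw [hF.card_edge t ht v hvt u hut huv.symm]
    have hpos : 0 < #{s ∈ A | u ∈ s} :=
      card_pos.2 ⟨t, by simp only [A, mem_filter]; exact ⟨⟨ht, hvt, hPt⟩, hut⟩⟩
    obtain ⟨k, hk⟩ := heven
    omega
  have : t' ∈ {s ∈ A | u ∈ s} := by
    rw [heq]
    simp [ht', hvt', hut']
  simp only [A, mem_filter] at this
  exact this.1.2.2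

/-- An automorphism which fixes the vertices of one triangle is the identity. -/
theorem eq_of_fixes_triangle (hF : IsCombSurface F) {e : V → V} (he : Function.Injective e)
    (heF : ∀ t ∈ F, t.image e ∈ F) {t₀ : Finset V} (ht₀ : t₀ ∈ F) (h₀ : ∀ x ∈ t₀, e x = x)
    (v : V) : e v = v := by
  have key : ∀ v, ∀ t ∈ F, v ∈ t → (∀ x ∈ t, e x = x) → ∀ t' ∈ F, v ∈ t' → ∀ x ∈ t', e x = x := by
    intro v
    refine hF.link v (fun t => ∀ x ∈ t, e x = x) fun t ht hfix hvt u hut huv t' ht' hvt' hut' => ?_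
    by_cases htt : t' = t
    · rwa [htt]
    have hcard := hF.card_edge t ht v hvt u hut huv.symm
    have h2 : ({t, t'} : Finset (Finset V)) = {s ∈ F | v ∈ s ∧ u ∈ s} := by
      refine eq_of_subset_of_card_le ?_ (by rw [hcard, card_pair (Ne.symm htt)])
      rw [insert_subset_iff, singleton_subset_iff]
      simp [ht, ht', hvt, hut, hvt', hut']
    have hv : e v = v := hfix v hvt
    have hu : e u = u := hfix u hut
    -- Only two triangles contain the fixed edge `vu`, and `t` is already its own image, so `t'` is
    -- preserved and its third vertex fixed.
    have himg : t'.image e ∈ ({t, t'} : Finset (Finset V)) := by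
      rw [h2, mem_filter]
      exact ⟨heF t' ht', mem_image.2 ⟨v, hvt', hv⟩, mem_image.2 ⟨u, hut', hu⟩⟩
    have htimg : t.image e = t := by
      conv_rhs => rw [← image_id (s := t)]
      exact image_congr fun x hx => hfix x hx
    rw [mem_insert, mem_singleton] at himg
    rcases himg with himg | himg
    · rw [← htimg] at himg
      exact (htt (image_injective he himg)).elim
    · obtain ⟨c, hvc, huc, rfl⟩ := exists_eq_triple (hF.card_eq t' ht') hvt' hut' huv.symm
      intro x hx
      have hc : e c ∈ ({v, u, c} : Finset V) := by
        rw [← himg]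
        exact mem_image_of_mem e (by simp)
      simp only [mem_insert, mem_singleton] at hc hx
      rcases hx with rfl | rfl | rfl
      · exact hv
      · exact hu
      · rcases hc with hc | hc | hc
        · exact (hvc (he (hv.trans hc.symm))).elim
        · exact (huc (he (hu.trans hc.symm))).elim
        · exact hc
  obtain ⟨a, ha⟩ : t₀.Nonempty := card_pos.1 (by rw [hF.card_eq t₀ ht₀]; norm_num)
  have hall := hF.conn {v | ∀ t ∈ F, v ∈ t → ∀ x ∈ t, e x = x}
    (fun t ht x hx y hy hxA => key y t ht hy (hxA t ht hx)) a (key a t₀ ht₀ ha h₀) v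
  obtain ⟨t, ht, hv⟩ := hF.cover v
  exact hall t ht hv v hv

/-- A rooted spanning tree of the `1`-skeleton, given by the parent function. -/
theorem exists_parent (hF : IsCombSurface F) (r : V) :
    ∃ (par : V → V) (d : V → ℕ), ∀ v, v ≠ r →
      par v ≠ v ∧ d (par v) < d v ∧ ∃ t ∈ F, v ∈ t ∧ par v ∈ t := by
  let G : SimpleGraph V :=
    { Adj a b := a ≠ b ∧ ∃ t ∈ F, a ∈ t ∧ b ∈ t
      symm := ⟨fun a b ⟨hab, t, ht, ha, hb⟩ => ⟨hab.symm, t, ht, hb, ha⟩⟩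
      loopless := ⟨fun a h => h.1 rfl⟩ }
  have hreach : ∀ v, G.Reachable v r := by
    intro v
    refine hF.conn {v | G.Reachable v r} (fun t ht a ha b hb hA => ?_) r
      (SimpleGraph.Reachable.refl r) v
    by_cases hab : b = a
    · rwa [hab]
    · have h1 : G.Adj b a := ⟨hab, t, ht, hb, ha⟩
      exact h1.reachable.trans hA
  -- The parent is the next vertex on a shortest path to the root.
  have hex : ∀ v, ∃ u, v ≠ r → G.Adj v u ∧ G.dist u r < G.dist v r := by
    intro v
    by_cases hv : v = r
    · exact ⟨v, fun h => (h hv).elim⟩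
    obtain ⟨p, hp⟩ := (hreach v).exists_walk_length_eq_dist
    cases p with
    | nil => exact (hv rfl).elim
    | cons h q =>
      refine ⟨_, fun _ => ⟨h, ?_⟩⟩
      rw [← hp, SimpleGraph.Walk.length_cons]
      exact Nat.lt_succ_of_le (SimpleGraph.dist_le q)
  choose par hpar using hex
  exact ⟨par, fun v => G.dist v r, fun v hv =>
    ⟨(hpar v hv).1.1.symm, (hpar v hv).2, (hpar v hv).1.2⟩⟩

end IsCombSurface

/-! ### Surfaces with labelled triangles -/

section Labelling

variable {V : Type*} [DecidableEq V] {f : ℕ}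

/-- The `i`-th triangle of a labelling of corners by vertices. -/
def tri (c : Fin f × Fin 3 → V) (i : Fin f) : Finset V := univ.image fun a => c (i, a)

/-- The map `c` sends the corners of `f` numbered triangles to the vertices of a surface. -/
structure IsLabelledSurface (c : Fin f × Fin 3 → V) : Prop where
  inj : ∀ i, Function.Injective fun a => c (i, a)
  tri_inj : Function.Injective (tri c)
  surf : IsCombSurface (univ.image (tri c))

theorem mem_tri {c : Fin f × Fin 3 → V} {i : Fin f} {v : V} : v ∈ tri c i ↔ ∃ a, c (i, a) = v := by
  simp [tri]

theorem tri_mem (c : Fin f × Fin 3 → V) (i : Fin f) : tri c i ∈ univ.image (tri c) :=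
  mem_image_of_mem _ (mem_univ i)

/-- The first end of the side opposite to the given corner. -/
def fstEnd (s : Fin f × Fin 3) : Fin f × Fin 3 := (s.1, s.2 + 1)

/-- The second end of the side opposite to the given corner. -/
def sndEnd (s : Fin f × Fin 3) : Fin f × Fin 3 := (s.1, s.2 + 2)

/-- The edge carrying the side opposite to the given corner. -/
def edge (c : Fin f × Fin 3 → V) (s : Fin f × Fin 3) : Finset V := {c (fstEnd s), c (sndEnd s)}

theorem exists_side {x y : Fin f × Fin 3} (h : x.1 = y.1) (hxy : x ≠ y) :
    ∃ s, (x = fstEnd s ∧ y = sndEnd s) ∨ (x = sndEnd s ∧ y = fstEnd s) := by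
  obtain ⟨i, a⟩ := x
  obtain ⟨j, b⟩ := y
  obtain rfl : i = j := h
  have hab : a ≠ b := fun h => hxy (by rw [h])
  have : ∃ k : Fin 3, (a = k + 1 ∧ b = k + 2) ∨ (a = k + 2 ∧ b = k + 1) := by
    clear hxy
    revert a b
    decide
  obtain ⟨k, hk⟩ := this
  refine ⟨(i, k), ?_⟩
  simpa [fstEnd, sndEnd] using hk

namespace IsLabelledSurface

variable {c : Fin f × Fin 3 → V}

theorem eq_of_fst_eq (hc : IsLabelledSurface c) {x y : Fin f × Fin 3} (h : x.1 = y.1)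
    (hxy : c x = c y) : x = y := by
  obtain ⟨i, a⟩ := x
  obtain ⟨j, b⟩ := y
  obtain rfl : i = j := h
  rw [hc.inj i hxy]

theorem fstEnd_ne_sndEnd (hc : IsLabelledSurface c) (s : Fin f × Fin 3) :
    c (fstEnd s) ≠ c (sndEnd s) := by
  intro h
  have := congrArg Prod.snd (hc.eq_of_fst_eq (x := fstEnd s) (y := sndEnd s) rfl h)
  simp [fstEnd, sndEnd] at this

theorem eq_of_edge_eq (hc : IsLabelledSurface c) {s s' : Fin f × Fin 3} (h : s.1 = s'.1)
    (he : edge c s = edge c s') : s = s' := by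
  obtain ⟨i, a⟩ := s
  obtain ⟨j, b⟩ := s'
  obtain rfl : i = j := h
  have h1 : c (i, a + 1) ∈ edge c (i, b) := he ▸ (by simp [edge, fstEnd])
  have h2 : c (i, a + 2) ∈ edge c (i, b) := he ▸ (by simp [edge, sndEnd])
  simp only [edge, fstEnd, sndEnd, mem_insert, mem_singleton] at h1 h2
  have h1' := h1.imp (fun h => hc.inj i h) (fun h => hc.inj i h)
  have h2' := h2.imp (fun h => hc.inj i h) (fun h => hc.inj i h)
  have : a = b := by
    clear h1 h2 he
    revert a b
    decide
  rw [this]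

theorem card_edge_eq (hc : IsLabelledSurface c) {a b : V} (hab : a ≠ b) {i : Fin f}
    (ha : a ∈ tri c i) (hb : b ∈ tri c i) : #{s | edge c s = {a, b}} = 2 := by
  rw [← hc.surf.card_edge _ (tri_mem c i) a ha b hb hab]
  refine card_bij (fun s _ => tri c s.1) ?_ ?_ ?_
  · intro s hs
    simp only [mem_filter, mem_univ, true_and] at hs
    have h1 : a ∈ edge c s := by simp [hs]
    have h2 : b ∈ edge c s := by simp [hs]
    have hsub : edge c s ⊆ tri c s.1 := by
      intro x hx
      simp only [edge, mem_insert, mem_singleton] at hx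
      rcases hx with rfl | rfl
      · exact mem_tri.2 ⟨_, rfl⟩
      · exact mem_tri.2 ⟨_, rfl⟩
    exact mem_filter.2 ⟨tri_mem c _, hsub h1, hsub h2⟩
  · intro s hs s' hs' h
    simp only [mem_filter, mem_univ, true_and] at hs hs'
    exact hc.eq_of_edge_eq (hc.tri_inj h) (hs.trans hs'.symm)
  · intro t ht
    simp only [mem_filter, mem_image, mem_univ, true_and] at ht
    obtain ⟨⟨j, rfl⟩, ha, hb⟩ := ht
    obtain ⟨x, rfl⟩ := mem_tri.1 ha
    obtain ⟨y, rfl⟩ := mem_tri.1 hb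
    obtain ⟨s, hs⟩ := exists_side (x := (j, x)) (y := (j, y)) rfl (fun h => hab (by rw [h]))
    refine ⟨s, ?_, ?_⟩
    · refine mem_filter.2 ⟨mem_univ _, ?_⟩
      rcases hs with ⟨h1, h2⟩ | ⟨h1, h2⟩
      · rw [h1, h2]; rfl
      · rw [h1, h2, pair_comm]; rfl
    · have : j = s.1 := by
        rcases hs with ⟨h1, -⟩ | ⟨h1, -⟩ <;> exact congrArg Prod.fst h1
      rw [this]

theorem exists_opp (hc : IsLabelledSurface c) : ∃ p : Fin f × Fin 3 → Fin f × Fin 3,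
    (∀ s, p s ≠ s) ∧ (∀ s, edge c (p s) = edge c s) ∧
      ∀ s s', edge c s' = edge c s → s' = s ∨ s' = p s := by
  have h : ∀ s, ∃ q, q ≠ s ∧ edge c q = edge c s ∧ ∀ s', edge c s' = edge c s → s' = s ∨ s' = q := by
    intro s
    have h2 := hc.card_edge_eq (hc.fstEnd_ne_sndEnd s) (i := s.1) (mem_tri.2 ⟨_, rfl⟩)
      (mem_tri.2 ⟨_, rfl⟩)
    change #{s' | edge c s' = edge c s} = 2 at h2
    obtain ⟨q, hq⟩ := card_eq_one.1 (show #(({s' | edge c s' = edge c s} :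
      Finset (Fin f × Fin 3)).erase s) = 1 by rw [card_erase_of_mem (by simp), h2])
    have hiff : ∀ s', s' ≠ s ∧ edge c s' = edge c s ↔ s' = q := by
      intro s'
      have := congr(s' ∈ $hq)
      simpa using this
    refine ⟨q, ((hiff q).2 rfl).1, ((hiff q).2 rfl).2, fun s' hs' => ?_⟩
    by_cases h : s' = s
    · exact Or.inl h
    · exact Or.inr ((hiff s').1 ⟨h, hs'⟩)
  choose p h1 h2 h3 using h
  exact ⟨p, h1, h2, h3⟩

end IsLabelledSurface

/-- A surface with labelled triangles, a rooted spanning tree `par` of its `1`-skeleton, and the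
involution `opp` which exchanges the two sides of each edge. -/
structure CutSurface (V : Type*) [DecidableEq V] (f : ℕ) where
  c : Fin f × Fin 3 → V
  labelled : IsLabelledSurface c
  root : V
  par : V → V
  depth : V → ℕ
  par_ne : ∀ v, v ≠ root → par v ≠ v
  depth_par : ∀ v, v ≠ root → depth (par v) < depth v
  exists_tri : ∀ v, v ≠ root → ∃ i, v ∈ tri c i ∧ par v ∈ tri c i
  opp : Fin f × Fin 3 → Fin f × Fin 3
  opp_ne : ∀ s, opp s ≠ s
  edge_opp : ∀ s, edge c (opp s) = edge c s
  eq_or_eq_opp : ∀ s s', edge c s' = edge c s → s' = s ∨ s' = opp s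

theorem IsLabelledSurface.exists_cutSurface {c : Fin f × Fin 3 → V} (hc : IsLabelledSurface c)
    (r : V) : ∃ D : CutSurface V f, D.c = c := by
  obtain ⟨p, h1, h2, h3⟩ := hc.exists_opp
  obtain ⟨par, d, hpar⟩ := hc.surf.exists_parent r
  refine ⟨⟨c, hc, r, par, d, fun v hv => (hpar v hv).1, fun v hv => (hpar v hv).2.1,
    fun v hv => ?_, p, h1, h2, h3⟩, rfl⟩
  obtain ⟨t, ht, hvt, hpt⟩ := (hpar v hv).2.2
  obtain ⟨i, -, rfl⟩ := mem_image.1 ht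
  exact ⟨i, hvt, hpt⟩

/-! ### Reconstruction of the surface from its gluing along the edges outside the tree -/

namespace CutSurface

variable (D : CutSurface V f)

/-- The pair `a, b` is an edge of the spanning tree. -/
def IsTree (a b : V) : Prop := (a ≠ D.root ∧ D.par a = b) ∨ (b ≠ D.root ∧ D.par b = a)

theorem isTree_comm {a b : V} : D.IsTree a b ↔ D.IsTree b a := Or.comm

/-- An equivalence relation on corners which is compatible with all edges outside the spanning tree,
and compatible with the parent end of a tree edge if it is so with the child end, identifies all
corners at the same vertex. -/
theorem rel_of_eq [Fintype V] (E : Setoid (Fin f × Fin 3))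
    (hglue : ∀ x y x' y', x.1 = y.1 → x ≠ y → x'.1 = y'.1 → x' ≠ y' → D.c x = D.c x' →
      D.c y = D.c y' → ¬ D.IsTree (D.c x) (D.c y) → E x x')
    (htree : ∀ x y x' y', x.1 = y.1 → x ≠ y → x'.1 = y'.1 → x' ≠ y' → D.c x = D.c x' →
      D.c y = D.c y' → D.c x ≠ D.root → D.par (D.c x) = D.c y → E x x' → E y y') :
    ∀ x y, D.c x = D.c y → E x y := by
  have hc := D.labelled
  let M := univ.sup D.depth
  have hM : ∀ v, D.depth v ≤ M := fun v => le_sup (f := D.depth) (mem_univ v)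
  suffices H : ∀ n v, M - D.depth v = n → ∀ x y, D.c x = v → D.c y = v → E x y from
    fun x y hxy => H _ (D.c y) rfl x y hxy rfl
  -- Induction on the distance below the maximal depth: all children of `v` are settled before `v`.
  intro n
  induction n using Nat.strong_induction_on with
  | _ n IH =>
  intro v hv x₀ y₀ hx₀ hy₀
  have IH' : ∀ u, D.depth v < D.depth u → ∀ x y, D.c x = u → D.c y = u → E x y := by
    intro u hu
    have := hM u
    exact IH (M - D.depth u) (by omega) u rfl
  let P : Finset V → Prop := fun t => ∀ x, tri D.c x.1 = t → D.c x = v → E x₀ x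
  have hstep : ∀ t ∈ univ.image (tri D.c), P t → v ∈ t → ∀ u ∈ t, u ≠ v →
      (v = D.root ∨ u ≠ D.par v) → ∀ t' ∈ univ.image (tri D.c), v ∈ t' → u ∈ t' → P t' := by
    intro t ht hPt hvt u hut huv hor t' ht' hvt' hut' x' hx' hx'v
    obtain ⟨i, -, rfl⟩ := mem_image.1 ht
    obtain ⟨a, ha⟩ := mem_tri.1 hvt
    obtain ⟨b, hb⟩ := mem_tri.1 hut
    subst hx'
    obtain ⟨b', hb'⟩ := mem_tri.1 hut'
    have hx : E x₀ (i, a) := hPt (i, a) rfl ha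
    refine E.trans hx ?_
    have hne : ((i, a) : Fin f × Fin 3) ≠ (i, b) := by
      intro h
      rw [h] at ha
      exact huv (hb.symm.trans ha)
    have hne' : x' ≠ (x'.1, b') := by
      intro h
      rw [← h] at hb'
      exact huv (hb'.symm.trans hx'v)
    by_cases htr : D.IsTree v u
    · rcases htr with ⟨h1, h2⟩ | ⟨h1, h2⟩
      · rcases hor with h | h
        · exact (h1 h).elim
        · exact (h h2.symm).elim
      -- The edge leads to a child `u`, whose corners are already identified; `htree` passes this on
      -- to its parent `v`.
      · have hd : D.depth v < D.depth u := by
          rw [← h2]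
          exact D.depth_par u h1
        exact htree (i, b) (i, a) (x'.1, b') x' rfl hne.symm rfl hne'.symm (hb.trans hb'.symm)
          (ha.trans hx'v.symm) (by rw [hb]; exact h1) (by rw [hb, ha, h2]) (IH' u hd _ _ hb hb')
    · exact hglue (i, a) (i, b) x' (x'.1, b') rfl hne rfl hne' (ha.trans hx'v.symm)
        (hb.trans hb'.symm) (by rwa [ha, hb])
  have hP₀ : P (tri D.c x₀.1) := by
    intro x hx hxv
    rw [hc.eq_of_fst_eq (hc.tri_inj hx) (hxv.trans hx₀.symm)]
  have hv₀ : v ∈ tri D.c x₀.1 := mem_tri.2 ⟨x₀.2, hx₀⟩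
  have hv₁ : v ∈ tri D.c y₀.1 := mem_tri.2 ⟨y₀.2, hy₀⟩
  -- The root has no parent edge, so its whole link is available. Elsewhere the parent edge is not
  -- yet usable and the link is cut there.
  by_cases hr : v = D.root
  · exact hc.surf.link v P (fun t ht hPt hvt u hut huv => hstep t ht hPt hvt u hut huv (Or.inl hr))
      _ (tri_mem _ x₀.1) hv₀ hP₀ _ (tri_mem _ y₀.1) hv₁ y₀ rfl hy₀
  · exact hc.surf.link_avoiding v (D.par v) P
      (fun t ht hPt hvt u hut huv hup => hstep t ht hPt hvt u hut huv (Or.inr hup))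
      _ (tri_mem _ x₀.1) hv₀ hP₀ _ (tri_mem _ y₀.1) hv₁ y₀ rfl hy₀

theorem opp_opp (s : Fin f × Fin 3) : D.opp (D.opp s) = s := by
  rcases D.eq_or_eq_opp (D.opp s) s (D.edge_opp s).symm with h | h
  · exact (D.opp_ne s h.symm).elim
  · exact h.symm

open Classical in
/-- The sides on edges of the spanning tree. -/
noncomputable def treeSides : Finset (Fin f × Fin 3) :=
  {s | D.IsTree (D.c (fstEnd s)) (D.c (sndEnd s))}

/-- Whether the first end of a side on a tree edge is the child. -/
def childBit (s : Fin f × Fin 3) : Prop :=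
  D.c (fstEnd s) ≠ D.root ∧ D.par (D.c (fstEnd s)) = D.c (sndEnd s)

/-- Whether the first ends of a side and its opposite side agree. -/
def orientBit (s : Fin f × Fin 3) : Prop :=
  D.c (fstEnd s) = D.c (fstEnd (D.opp s))

/-- One side of each edge outside the spanning tree. -/
noncomputable def halfSides : Finset (Fin f × Fin 3) :=
  {s ∈ D.treeSidesᶜ | finProdFinEquiv s < finProdFinEquiv (D.opp s)}

theorem mem_treeSides {s : Fin f × Fin 3} :
    s ∈ D.treeSides ↔ D.IsTree (D.c (fstEnd s)) (D.c (sndEnd s)) := by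
  simp [treeSides]

theorem mem_treeSides_iff_exists {s : Fin f × Fin 3} :
    s ∈ D.treeSides ↔ ∃ v, v ≠ D.root ∧ edge D.c s = {v, D.par v} := by
  rw [mem_treeSides]
  constructor
  · rintro (⟨h1, h2⟩ | ⟨h1, h2⟩)
    · exact ⟨_, h1, by rw [h2]; rfl⟩
    · exact ⟨_, h1, by rw [h2, pair_comm]; rfl⟩
  · rintro ⟨v, hv, he⟩
    have h1 : v ∈ edge D.c s := by simp [he]
    have h2 : D.par v ∈ edge D.c s := by simp [he]
    simp only [edge, mem_insert, mem_singleton] at h1 h2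
    rcases h1 with rfl | rfl
    · exact Or.inl ⟨hv, h2.resolve_left (D.par_ne _ hv)⟩
    · exact Or.inr ⟨hv, h2.resolve_right (D.par_ne _ hv)⟩

theorem opp_mem_treeSides {s : Fin f × Fin 3} : D.opp s ∈ D.treeSides ↔ s ∈ D.treeSides := by
  simp only [mem_treeSides_iff_exists, D.edge_opp]

/-- Each vertex other than the root owns the edge to its parent, which has two sides. Two vertices
cannot own the same edge, since each would be deeper than the other. -/
theorem card_treeSides [Fintype V] : #D.treeSides + 2 = 2 * Fintype.card V := by
  have hU : D.treeSides = (univ.erase D.root).biUnion fun v =>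
      {s | edge D.c s = {v, D.par v}} := by
    ext s
    simp [mem_treeSides_iff_exists]
  have hdisj : (↑(univ.erase D.root) : Set V).PairwiseDisjoint fun v =>
      ({s | edge D.c s = {v, D.par v}} : Finset (Fin f × Fin 3)) := by
    intro v hv v' hv' hne
    simp only [coe_erase, coe_univ, Set.mem_sdiff, Set.mem_univ, Set.mem_singleton_iff,
      true_and] at hv hv'
    refine disjoint_left.2 fun s hs hs' => ?_
    simp only [mem_filter, mem_univ, true_and] at hs hs'
    rw [hs] at hs'
    have h1 : v ∈ ({v', D.par v'} : Finset V) := by rw [← hs']; simp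
    have h2 : v' ∈ ({v, D.par v} : Finset V) := by rw [hs']; simp
    simp only [mem_insert, mem_singleton] at h1 h2
    have h1 := h1.resolve_left hne
    have h2 := h2.resolve_left (Ne.symm hne)
    have h3 := D.depth_par v hv
    have h4 := D.depth_par v' hv'
    rw [← h2] at h3
    rw [← h1] at h4
    omega
  rw [hU, card_biUnion hdisj, sum_const_nat (m := 2), card_erase_of_mem (mem_univ _), card_univ]
  · have : 0 < Fintype.card V := Fintype.card_pos_iff.2 ⟨D.root⟩
    omega
  · intro v hv
    simp only [mem_erase, mem_univ, and_true] at hv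
    obtain ⟨i, h1, h2⟩ := D.exists_tri v hv
    exact D.labelled.card_edge_eq (D.par_ne v hv).symm h1 h2

/-- `opp` exchanges the recorded and the unrecorded sides off the tree. Every vertex saves one
recorded partner, which is the source of the factor w^(-w) in the final bound. -/
theorem card_halfSides [Fintype V] : 2 * #D.halfSides + 2 * Fintype.card V = 3 * f + 2 := by
  have h1 := card_filter_add_card_filter_not (s := D.treeSidesᶜ)
    (fun s => finProdFinEquiv s < finProdFinEquiv (D.opp s))
  have h2 : #{s ∈ D.treeSidesᶜ | ¬ finProdFinEquiv s < finProdFinEquiv (D.opp s)} =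
      #D.halfSides := by
    refine card_nbij' D.opp D.opp ?_ ?_ (fun s _ => D.opp_opp s) (fun s _ => D.opp_opp s)
    · intro s hs
      simp only [halfSides, coe_filter, mem_compl, Set.mem_ofPred_eq, opp_mem_treeSides,
        opp_opp] at hs ⊢
      refine ⟨hs.1, lt_of_le_of_ne (not_lt.1 hs.2) fun h => D.opp_ne s ?_⟩
      exact finProdFinEquiv.injective h
    · intro s hs
      simp only [halfSides, coe_filter, mem_compl, Set.mem_ofPred_eq, opp_mem_treeSides,
        opp_opp] at hs ⊢
      exact ⟨hs.1, not_lt.2 hs.2.le⟩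
  have h3 := card_compl_add_card D.treeSides
  have h4 := D.card_treeSides
  have h5 : Fintype.card (Fin f × Fin 3) = f * 3 := by simp
  rw [h2] at h1
  change #D.halfSides + _ = _ at h1
  omega

section Decoding

variable {D} {D' : CutSurface V f}

theorem eq_ends (D : CutSurface V f) {s s' : Fin f × Fin 3} (h : edge D.c s = edge D.c s') :
    (D.c (fstEnd s) = D.c (fstEnd s') ∧ D.c (sndEnd s) = D.c (sndEnd s')) ∨
      (D.c (fstEnd s) ≠ D.c (fstEnd s') ∧ D.c (fstEnd s) = D.c (sndEnd s') ∧
        D.c (sndEnd s) = D.c (fstEnd s')) := by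
  have hs := D.labelled.fstEnd_ne_sndEnd s
  have hs' := D.labelled.fstEnd_ne_sndEnd s'
  have h1 : D.c (fstEnd s) ∈ edge D.c s' := by rw [← h]; simp [edge]
  have h2 : D.c (sndEnd s) ∈ edge D.c s' := by rw [← h]; simp [edge]
  simp only [edge, mem_insert, mem_singleton] at h1 h2
  rcases h1 with h1 | h1 <;> rcases h2 with h2 | h2
  · exact (hs (h1.trans h2.symm)).elim
  · exact Or.inl ⟨h1, h2⟩
  · exact Or.inr ⟨fun h => hs' (h.symm.trans h1), h1, h2⟩
  · exact (hs (h1.trans h2.symm)).elim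

theorem par_eq_of_bits_eq (hU : D.treeSides = D'.treeSides) (hch : D.childBit = D'.childBit)
    {x y : Fin f × Fin 3} (hxy : x.1 = y.1) (hne : x ≠ y) (hr : D.c x ≠ D.root)
    (hpar : D.par (D.c x) = D.c y) : D'.par (D'.c x) = D'.c y := by
  obtain ⟨s, ⟨rfl, rfl⟩ | ⟨rfl, rfl⟩⟩ := exists_side hxy hne
  · have h : D.childBit s := ⟨hr, hpar⟩
    rw [hch] at h
    exact h.2
  · have hs : s ∈ D.treeSides := D.mem_treeSides.2 (Or.inr ⟨hr, hpar⟩)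
    have h : ¬ D.childBit s := by
      rintro ⟨h1, h2⟩
      have h3 := D.depth_par _ hr
      have h4 := D.depth_par _ h1
      rw [hpar] at h3
      rw [h2] at h4
      omega
    rw [hU, mem_treeSides] at hs
    rw [hch] at h
    exact (hs.resolve_left h).2

theorem eq_of_mem_halfSides (ho : D.orientBit = D'.orientBit) {s : Fin f × Fin 3}
    (hp : D.opp s = D'.opp s) {x y x' y' : Fin f × Fin 3}
    (hs : (x = fstEnd s ∧ y = sndEnd s) ∨ (x = sndEnd s ∧ y = fstEnd s))
    (hs' : (x' = fstEnd (D.opp s) ∧ y' = sndEnd (D.opp s)) ∨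
      (x' = sndEnd (D.opp s) ∧ y' = fstEnd (D.opp s)))
    (hx : D.c x = D.c x') : D'.c x = D'.c x' := by
  have h1 := D.eq_ends (D.edge_opp s).symm
  have h2 := D'.eq_ends (D'.edge_opp s).symm
  rw [← hp] at h2
  have h3 : D.orientBit s ↔ D'.orientBit s := by rw [ho]
  simp only [orientBit, ← hp] at h3
  have h4 := D.labelled.fstEnd_ne_sndEnd (D.opp s)
  rcases hs with ⟨rfl, rfl⟩ | ⟨rfl, rfl⟩ <;> rcases hs' with ⟨rfl, rfl⟩ | ⟨rfl, rfl⟩ <;> grind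

/-- Apply `rel_of_eq` to the kernel of `D'.c`. Off the tree the gluings agree by the record; on the
tree no partner is needed, because in `D'` too the parent is a function of the child. -/
theorem eq_of_bits_eq [Fintype V] (hU : D.treeSides = D'.treeSides)
    (hch : D.childBit = D'.childBit) (ho : D.orientBit = D'.orientBit)
    (hp : ∀ s ∈ D.halfSides, D.opp s = D'.opp s) :
    ∀ x y, D.c x = D.c y → D'.c x = D'.c y := by
  refine D.rel_of_eq (Setoid.ker D'.c) ?_ ?_
  · intro x y x' y' hxy hne hxy' hne' hx hy htr
    rw [Setoid.ker_def]
    by_cases hxx : x.1 = x'.1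
    · rw [D.labelled.eq_of_fst_eq hxx hx]
    obtain ⟨s, hs⟩ := exists_side hxy hne
    obtain ⟨s', hs'⟩ := exists_side hxy' hne'
    have hedge : edge D.c s = {D.c x, D.c y} := by
      rcases hs with ⟨rfl, rfl⟩ | ⟨rfl, rfl⟩
      · rfl
      · rw [pair_comm]; rfl
    have hedge' : edge D.c s' = {D.c x', D.c y'} := by
      rcases hs' with ⟨rfl, rfl⟩ | ⟨rfl, rfl⟩
      · rfl
      · rw [pair_comm]; rfl
    have hss : s' ≠ s := by
      rintro rfl
      apply hxx
      rcases hs with ⟨rfl, -⟩ | ⟨rfl, -⟩ <;> rcases hs' with ⟨rfl, -⟩ | ⟨rfl, -⟩ <;> rfl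
    have hopp : s' = D.opp s :=
      (D.eq_or_eq_opp s s' (by rw [hedge, hedge', hx, hy])).resolve_left hss
    have hsU : s ∉ D.treeSides := by
      rw [mem_treeSides]
      rcases hs with ⟨rfl, rfl⟩ | ⟨rfl, rfl⟩
      · exact htr
      · rwa [isTree_comm]
    rcases lt_or_gt_of_ne (finProdFinEquiv.injective.ne hss) with hlt | hlt
    · have hopp' : D.opp s' = s := by rw [hopp, opp_opp]
      have hR : s' ∈ D.halfSides := by
        simp only [halfSides, mem_filter, mem_compl]
        refine ⟨?_, by rwa [hopp']⟩
        rwa [hopp, opp_mem_treeSides]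
      exact (eq_of_mem_halfSides ho (hp s' hR) hs' (by rwa [hopp']) hx.symm).symm
    · have hR : s ∈ D.halfSides := by
        simp only [halfSides, mem_filter, mem_compl]
        exact ⟨hsU, by rwa [← hopp]⟩
      exact eq_of_mem_halfSides ho (hp s hR) hs (by rwa [← hopp]) hx
  · intro x y x' y' hxy hne hxy' hne' hx hy hr hpar hE
    rw [Setoid.ker_def] at hE ⊢
    rw [← par_eq_of_bits_eq hU hch hxy hne hr hpar,
      ← par_eq_of_bits_eq hU hch hxy' hne' (hx ▸ hr) (by rw [← hx, ← hy, hpar]), hE]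

end Decoding

/-- The data from which a surface with labelled triangles is recovered, up to renaming the
vertices. -/
abbrev Code (f m : ℕ) : Type :=
  Finset (Fin f × Fin 3) × Finset (Fin f × Fin 3) × Finset (Fin f × Fin 3) ×
    Finset (Fin f × Fin 3) × (Fin m → Fin f × Fin 3)

open Classical in
/-- The code of a surface cut open along its spanning tree. -/
noncomputable def code {m : ℕ} (hm : #D.halfSides = m) : Code f m :=
  (D.treeSides, univ.filter D.childBit, univ.filter D.orientBit, D.halfSides,
    fun k => D.opp ((D.halfSides.equivFinOfCardEq hm).symm k))

theorem eq_iff_of_code_eq [Fintype V] {D D' : CutSurface V f} {m : ℕ} (hm : #D.halfSides = m)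
    (hm' : #D'.halfSides = m) (h : D.code hm = D'.code hm') (x y : Fin f × Fin 3) :
    D.c x = D.c y ↔ D'.c x = D'.c y := by
  simp only [code, Prod.mk.injEq] at h
  obtain ⟨hU, hch, ho, hR, hp⟩ := h
  have hch' : D.childBit = D'.childBit := by
    funext s
    simpa using congr(s ∈ $hch)
  have ho' : D.orientBit = D'.orientBit := by
    funext s
    simpa using congr(s ∈ $ho)
  -- The enumerations depend on the sets, so the two sets are generalized to variables before being
  -- identified.
  have key : ∀ (A B : Finset (Fin f × Fin 3)) (hA : #A = m) (hB : #B = m)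
      (p q : Fin f × Fin 3 → Fin f × Fin 3), A = B →
      ((fun k => p ((A.equivFinOfCardEq hA).symm k)) =
        fun k => q ((B.equivFinOfCardEq hB).symm k)) → ∀ s ∈ A, p s = q s := by
    rintro A _ hA hB p q rfl hpq s hs
    simpa using congrFun hpq (A.equivFinOfCardEq hA ⟨s, hs⟩)
  have hp' := key _ _ hm hm' D.opp D'.opp hR hp
  exact ⟨eq_of_bits_eq hU hch' ho' hp' x y,
    eq_of_bits_eq hU.symm hch'.symm ho'.symm (fun s hs => (hp' s (hR ▸ hs)).symm) x y⟩

theorem card_code (f m : ℕ) : Fintype.card (Code f m) = (2 ^ (f * 3)) ^ 4 * (f * 3) ^ m := by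
  simp only [Code, Fintype.card_prod, Fintype.card_finset, Fintype.card_fin, Fintype.card_fun]
  ring

end CutSurface

end Labelling

end TriangulatedSurface

namespace TriangulatedSurface

open Finset

/-! ### Counting surfaces -/

section Counting

namespace IsLabelledSurface

variable {V : Type*} [DecidableEq V] {f : ℕ} {c : Fin f × Fin 3 → V}

theorem surjective (hc : IsLabelledSurface c) : Function.Surjective c := by
  intro v
  obtain ⟨t, ht, hv⟩ := hc.surf.cover v
  obtain ⟨i, -, rfl⟩ := mem_image.1 ht
  obtain ⟨a, ha⟩ := mem_tri.1 hv
  exact ⟨_, ha⟩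

/-- Renumbering the triangles. -/
theorem image_tri_perm (c : Fin f × Fin 3 → V) (π : Equiv.Perm (Fin f)) :
    univ.image (tri fun x => c (π x.1, x.2)) = univ.image (tri c) := by
  ext t
  simp only [mem_image, mem_univ, true_and]
  exact ⟨fun ⟨i, hi⟩ => ⟨π i, hi⟩, fun ⟨i, hi⟩ => ⟨π.symm i, by rw [← hi]; simp [tri]⟩⟩

theorem perm (hc : IsLabelledSurface c) (π : Equiv.Perm (Fin f)) :
    IsLabelledSurface fun x => c (π x.1, x.2) where
  inj i := hc.inj (π i)
  tri_inj := hc.tri_inj.comp π.injective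
  surf := by
    rw [image_tri_perm]
    exact hc.surf

/-- Labellings which identify the same corners differ by a bijection of the vertices. -/
theorem exists_equiv {W : Type*} [DecidableEq W] {c' : Fin f × Fin 3 → W}
    (hc : IsLabelledSurface c) (hc' : IsLabelledSurface c')
    (h : ∀ x y, c x = c y ↔ c' x = c' y) : ∃ e : V ≃ W, ∀ x, e (c x) = c' x := by
  let g := Function.surjInv hc.surjective
  have hg : ∀ x, c' (g (c x)) = c' x := fun x =>
    (h _ _).1 (Function.surjInv_eq hc.surjective (c x))
  refine ⟨Equiv.ofBijective (fun v => c' (g v)) ⟨fun v v' hvv => ?_, fun u => ?_⟩, hg⟩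
  · have := (h _ _).2 hvv
    rwa [Function.surjInv_eq hc.surjective, Function.surjInv_eq hc.surjective] at this
  · obtain ⟨x, rfl⟩ := hc'.surjective u
    exact ⟨c x, hg x⟩

end IsLabelledSurface

theorem tri_map {V W : Type*} [DecidableEq V] [DecidableEq W] {f : ℕ} {c : Fin f × Fin 3 → V}
    {c' : Fin f × Fin 3 → W} (e : V ≃ W) (he : ∀ x, e (c x) = c' x) (i : Fin f) :
    tri c' i = (tri c i).map e.toEmbedding := by
  ext u
  simp [mem_tri, ← he, ← Equiv.eq_symm_apply]

theorem IsCombSurface.exists_labelling {V : Type*} [DecidableEq V] {F : Finset (Finset V)}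
    (hF : IsCombSurface F) {f : ℕ} (hf : #F = f) :
    ∃ c : Fin f × Fin 3 → V, IsLabelledSurface c ∧ univ.image (tri c) = F := by
  let σ : Fin f ≃ F := (F.equivFinOfCardEq hf).symm
  have hg : ∀ t : F, ∃ g : Fin 3 → V, Function.Injective g ∧ univ.image g = t := by
    rintro ⟨t, ht⟩
    let e := (t.equivFinOfCardEq (hF.card_eq t ht)).symm
    refine ⟨fun k => e k, Subtype.val_injective.comp e.injective, ?_⟩
    ext x
    simp only [mem_image, mem_univ, true_and]
    exact ⟨fun ⟨k, hk⟩ => hk ▸ (e k).2, fun hx => ⟨e.symm ⟨x, hx⟩, by simp⟩⟩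
  choose g hinj himg using hg
  have htri : tri (fun x : Fin f × Fin 3 => g (σ x.1) x.2) = fun i => (σ i : Finset V) :=
    funext fun i => himg (σ i)
  have hF' : univ.image (tri fun x : Fin f × Fin 3 => g (σ x.1) x.2) = F := by
    ext t
    simp only [htri, mem_image, mem_univ, true_and]
    exact ⟨fun ⟨i, hi⟩ => hi ▸ (σ i).2, fun ht => ⟨σ.symm ⟨t, ht⟩, by simp⟩⟩
  refine ⟨_, ⟨fun i => hinj (σ i), ?_, by rwa [hF']⟩, hF'⟩
  rw [htri]
  exact Subtype.val_injective.comp σ.injective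

theorem exists_labelling {f w : ℕ} (L : LabelledSurface f w) :
    ∃ c : Fin f × Fin 3 → Fin w, IsLabelledSurface c ∧ univ.image (tri c) = triangles L.1 :=
  (isCombSurface_triangles L.2.1 L.2.2.1).exists_labelling
    ((card_triangles L.1).trans L.2.2.2)

theorem simpliciallyIsomorphic_of_labelling {f w : ℕ} (L L' : LabelledSurface f w)
    {c c' : Fin f × Fin 3 → Fin w} (hc : univ.image (tri c) = triangles L.1)
    (hc' : univ.image (tri c') = triangles L'.1) (e : Fin w ≃ Fin w) (he : ∀ x, e (c x) = c' x) :
    SimpliciallyIsomorphic L.1 L'.1 := by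
  refine ⟨e, fun s => ?_⟩
  rw [L.2.1.locallyPlanar.mem_iff_exists_triangle, L'.2.1.locallyPlanar.mem_iff_exists_triangle,
    map_nonempty, ← hc, ← hc']
  simp [tri_map e he]

/-- Pairs of a class and a renumbering of its triangles inject into codes with the labels of one
triangle. Equal codes give a vertex bijection, so the classes agree; it is then an automorphism
fixing a triangle, hence the identity, and the renumberings agree. -/
theorem card_T_mul_factorial_le {f w m : ℕ} (hf : 0 < f) (hm : 2 * m + 2 * w = 3 * f + 2) :
    Nat.card (T f w) * f.factorial ≤ (2 ^ (f * 3)) ^ 4 * (f * 3) ^ m * w ^ 3 := by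
  classical
  let L : T f w → LabelledSurface f w := Quotient.out
  choose c₀ hc₀ himg using fun q : T f w => exists_labelling (L q)
  let i₀ : Fin f := ⟨0, hf⟩
  let c : T f w × Equiv.Perm (Fin f) → Fin f × Fin 3 → Fin w := fun a x =>
    c₀ a.1 (a.2 x.1, x.2)
  have hc : ∀ a, IsLabelledSurface (c a) := fun a => (hc₀ a.1).perm a.2
  have hcimg : ∀ a, univ.image (tri (c a)) = triangles (L a.1).1 := fun a => by
    rw [← himg]
    exact IsLabelledSurface.image_tri_perm _ _
  choose D hD using fun a => (hc a).exists_cutSurface (c a (i₀, 0))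
  have hDm : ∀ a, #(D a).halfSides = m := fun a => by
    have := (D a).card_halfSides
    rw [Fintype.card_fin] at this
    omega
  let Φ : T f w × Equiv.Perm (Fin f) → CutSurface.Code f m × (Fin 3 → Fin w) := fun a =>
    ((D a).code (hDm a), fun k => c a (i₀, k))
  have hΦ : Function.Injective Φ := by
    intro a b hab
    simp only [Φ, Prod.mk.injEq] at hab
    obtain ⟨hcode, hfix⟩ := hab
    have hker := CutSurface.eq_iff_of_code_eq (hDm a) (hDm b) hcode
    rw [hD, hD] at hker
    obtain ⟨e, he⟩ := (hc a).exists_equiv (hc b) hker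
    have hq : a.1 = b.1 := by
      have : (isoSetoid f w) (L a.1) (L b.1) :=
        simpliciallyIsomorphic_of_labelling _ _ (hcimg a) (hcimg b) e he
      exact Quotient.out_equiv_out.1 this
    have heF : ∀ t ∈ univ.image (tri (c a)), t.image e ∈ univ.image (tri (c a)) := by
      intro t ht
      obtain ⟨i, -, rfl⟩ := mem_image.1 ht
      have h1 := tri_map e he i
      rw [map_eq_image] at h1
      change _ = (tri (c a) i).image e at h1
      rw [← h1, hcimg a, hq, ← hcimg b]
      exact tri_mem _ _
    have hid : ∀ v, e v = v := (hc a).surf.eq_of_fixes_triangle e.injective heF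
      (tri_mem (c a) i₀) (by
        intro x hx
        obtain ⟨k, rfl⟩ := mem_tri.1 hx
        rw [he]
        exact (congrFun hfix k).symm)
    have hcab : c a = c b := by
      funext x
      rw [← he, hid]
    obtain ⟨q, π⟩ := a
    obtain ⟨q', π'⟩ := b
    obtain rfl : q = q' := hq
    have : π = π' := by
      ext i : 1
      apply (hc₀ q).tri_inj
      simp only [tri]
      congr 1
      funext k
      exact congrFun hcab (i, k)
    rw [this]
  have hcard := Nat.card_le_card_of_injective Φ hΦ
  rw [Nat.card_prod, Nat.card_prod, Nat.card_eq_fintype_card (α := Equiv.Perm (Fin f)),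
    Fintype.card_perm, Fintype.card_fin, Nat.card_eq_fintype_card (α := CutSurface.Code f m),
    CutSurface.card_code, Nat.card_eq_fintype_card (α := Fin 3 → Fin w), Fintype.card_fun,
    Fintype.card_fin, Fintype.card_fin] at hcard
  exact hcard

theorem exists_of_labelledSurface {f w : ℕ} (L : LabelledSurface f w) :
    0 < f ∧ 0 < w ∧ w ≤ f * 3 ∧ ∃ m, 2 * m + 2 * w = 3 * f + 2 := by
  obtain ⟨c, hc, -⟩ := exists_labelling L
  have : ConnectedSpace (realization L.1) := L.2.2.1
  obtain ⟨x⟩ : Nonempty (realization L.1) := inferInstance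
  obtain ⟨v⟩ : Nonempty (Fin w) := by
    by_contra h
    rw [not_nonempty_iff] at h
    have := x.2.1.2
    simp at this
  obtain ⟨y, -⟩ := hc.surjective v
  obtain ⟨D, -⟩ := hc.exists_cutSurface v
  refine ⟨y.1.pos, v.pos, ?_, _, by simpa using D.card_halfSides⟩
  simpa using Fintype.card_le_of_surjective c hc.surjective

/-- In the constant, e comes from f! ≥ (f/e)^f, 2^12 from four sets of sides, 3^2 bounds 3^(3/2),
and 8^4 absorbs four factors at most 3f ≤ 8^f: one from the +1 in m, three from w^3. -/
theorem count_bound {N f w m : ℕ} (hf : 0 < f) (hw : 0 < w) (hwf : w ≤ f * 3)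
    (hm : 2 * m + 2 * w = 3 * f + 2)
    (hN : N * f.factorial ≤ (2 ^ (f * 3)) ^ 4 * (f * 3) ^ m * w ^ 3) {δ : ℝ} (hδ : 0 < δ) :
    (N : ℝ) ≤ (Real.exp 1 * 2 ^ 12 * 3 ^ 2 * 8 ^ 4) ^ f * (f : ℝ) ^ ((f : ℝ) / 2) *
      (w : ℝ) ^ (-(1 - δ) * (w : ℝ)) := by
  have hf' : (0 : ℝ) < f := by exact_mod_cast hf
  have hw' : (0 : ℝ) < w := by exact_mod_cast hw
  have h3f : (0 : ℝ) < (f : ℝ) * 3 := by positivity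
  have hwf' : (w : ℝ) ≤ (f : ℝ) * 3 := by exact_mod_cast hwf
  have hmR : (m : ℝ) = (3 / 2 * f) + (1 - w) := by
    have : (2 * m + 2 * w : ℝ) = 3 * f + 2 := by exact_mod_cast hm
    linarith
  have hfact : (f : ℝ) ^ f ≤ Real.exp 1 ^ f * f.factorial := by
    have := Real.pow_div_factorial_le_exp (f : ℝ) hf'.le f
    rw [div_le_iff₀ (by positivity)] at this
    rwa [← Real.exp_nat_mul, mul_one]
  have h8 : (f : ℝ) * 3 ≤ 8 ^ f := by
    have h1 : f * 3 ≤ 8 ^ f := by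
      calc f * 3 ≤ 2 ^ f * 2 ^ (2 * f) := by
            refine Nat.mul_le_mul Nat.lt_two_pow_self.le ?_
            calc 3 ≤ 2 ^ 2 := by norm_num
              _ ≤ 2 ^ (2 * f) := Nat.pow_le_pow_right (by norm_num) (by omega)
        _ = 8 ^ f := by rw [pow_mul, ← mul_pow]; norm_num
    exact_mod_cast h1
  -- The only use of `δ > 0`: w^(-w) is already an upper bound, and it is weakened here.
  have hwpow : ((f : ℝ) * 3) ^ (-(w : ℝ)) ≤ (w : ℝ) ^ (-(1 - δ) * (w : ℝ)) := by
    calc ((f : ℝ) * 3) ^ (-(w : ℝ)) ≤ (w : ℝ) ^ (-(w : ℝ)) :=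
          Real.rpow_le_rpow_of_nonpos hw' hwf' (by linarith)
      _ ≤ (w : ℝ) ^ (-(1 - δ) * (w : ℝ)) := by
          apply Real.rpow_le_rpow_of_exponent_le (by exact_mod_cast hw)
          nlinarith [mul_pos hδ hw']
  have hmpow : ((f : ℝ) * 3) ^ m ≤ 9 ^ f * (f : ℝ) ^ f * (f : ℝ) ^ ((f : ℝ) / 2) *
      8 ^ f * (w : ℝ) ^ (-(1 - δ) * (w : ℝ)) := by
    have h1 : ((f : ℝ) * 3) ^ m = ((f : ℝ) * 3) ^ (3 / 2 * (f : ℝ)) * ((f : ℝ) * 3) *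
        ((f : ℝ) * 3) ^ (-(w : ℝ)) := by
      rw [← Real.rpow_natCast, hmR, Real.rpow_add h3f, sub_eq_add_neg, Real.rpow_add h3f,
        Real.rpow_one]
      ring
    have h2 : ((f : ℝ) * 3) ^ (3 / 2 * (f : ℝ)) ≤
        9 ^ f * ((f : ℝ) ^ f * (f : ℝ) ^ ((f : ℝ) / 2)) := by
      rw [Real.mul_rpow hf'.le (by norm_num), mul_comm]
      have h3 : (3 : ℝ) ^ (3 / 2 * (f : ℝ)) ≤ 9 ^ f := by
        rw [show (9 : ℝ) ^ f = 3 ^ (2 * (f : ℝ)) by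
          rw [Real.rpow_mul (by norm_num), Real.rpow_natCast]; norm_num]
        apply Real.rpow_le_rpow_of_exponent_le (by norm_num)
        nlinarith
      have h4 : (f : ℝ) ^ (3 / 2 * (f : ℝ)) = (f : ℝ) ^ f * (f : ℝ) ^ ((f : ℝ) / 2) := by
        rw [← Real.rpow_natCast, ← Real.rpow_add hf']
        congr 1
        ring
      rw [h4]
      gcongr
    rw [h1]
    calc _ ≤ 9 ^ f * ((f : ℝ) ^ f * (f : ℝ) ^ ((f : ℝ) / 2)) * 8 ^ f *
          (w : ℝ) ^ (-(1 - δ) * (w : ℝ)) := by gcongr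
      _ = _ := by ring
  have hw3 : (w : ℝ) ^ 3 ≤ (8 ^ f) ^ 3 := by
    gcongr
    exact hwf'.trans h8
  have hN' : (N : ℝ) * f.factorial ≤ (2 ^ (f * 3)) ^ 4 * ((f : ℝ) * 3) ^ m * (w : ℝ) ^ 3 := by
    exact_mod_cast hN
  have hff : (0 : ℝ) < (f : ℝ) ^ f := by positivity
  refine le_of_mul_le_mul_right ?_ hff
  calc (N : ℝ) * (f : ℝ) ^ f ≤ N * (Real.exp 1 ^ f * f.factorial) := by gcongr
    _ = Real.exp 1 ^ f * (N * f.factorial) := by ring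
    _ ≤ Real.exp 1 ^ f * ((2 ^ (f * 3)) ^ 4 * ((f : ℝ) * 3) ^ m * (w : ℝ) ^ 3) := by gcongr
    _ ≤ Real.exp 1 ^ f * ((2 ^ (f * 3)) ^ 4 * (9 ^ f * (f : ℝ) ^ f * (f : ℝ) ^ ((f : ℝ) / 2) *
      8 ^ f * (w : ℝ) ^ (-(1 - δ) * (w : ℝ))) * (8 ^ f) ^ 3) := by gcongr
    _ = _ := by
      rw [mul_pow, mul_pow, mul_pow, ← pow_mul 2 12 f, ← pow_mul 2 (f * 3) 4,
        show f * 3 * 4 = 12 * f by ring, show ((3 : ℝ) ^ 2) = 9 by norm_num, ← pow_mul 8 4 f,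
        ← pow_mul 8 f 3, show 4 * f = f + f * 3 by ring, pow_add 8]
      ring

end Counting

end TriangulatedSurface

theorem theorem5p1 (δ : ℝ) (hδ : 0 < δ) :
    ∃ C : ℝ, 0 < C ∧ ∀ f w : ℕ,
      (Nat.card (TriangulatedSurface.T f w) : ℝ) ≤
        C ^ f * (f : ℝ) ^ ((f : ℝ) / 2) * (w : ℝ) ^ (-(1 - δ) * (w : ℝ)) := by
  -- The constant does not depend on `δ`. The cases `f = 0` or `w = 0` fall under the empty case.
  refine ⟨Real.exp 1 * 2 ^ 12 * 3 ^ 2 * 8 ^ 4, by positivity, fun f w => ?_⟩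
  rcases isEmpty_or_nonempty (TriangulatedSurface.T f w) with h | ⟨⟨q⟩⟩
  · rw [Nat.card_of_isEmpty, Nat.cast_zero]
    positivity
  · obtain ⟨hf, hw, hwf, m, hm⟩ :=
      TriangulatedSurface.exists_of_labelledSurface (Quotient.out q)
    exact TriangulatedSurface.count_bound hf hw hwf hm
      (TriangulatedSurface.card_T_mul_factorial_le hf hm) hδ
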